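/- Let $C=\{T,F,U\}$ carry the operations - negation: $T'=F$, $F'=T$, $U'=U$; - conjunction: $T\wedge y=y$, $F\wedge y=F$, $U\wedge y=U$; - disjunction: $T\vee y=T$, $F\vee y=y$, $U\vee y=U$. Consider the equations (1.1a) $x''=x$, (1.1b) $(x\wedge y)'=x'\vee y'$, (1.1c) $(x\wedge y)\wedge z=x\wedge(y\wedge z)$, (1.1d) $x\wedge(y\vee z)=(x\wedge y)\vee(x\wedge z)$, (1.1e) $(x\vee y)\wedge z=(x\wedge z)\vee(x'\wedge y\wedge z)$, (1.1f) $x\vee(x\wedge y)=x$, (1.1g) $(x\wedge y)\vee(y\wedge x)=(y\wedge x)\vee(x\wedge y)$, the two readings of (1.1e) (Mem1) $(x\vee y)\wedge z=(x\wedge z)\vee(x'\wedge(y\wedge z))$, (Mem2) $(x\vee y)\wedge z=(x\wedge z)\vee((x'\wedge y)\wedge z)$, and the equations for constants (1.4a) $U'=U$, (1.4b) $T\wedge x=x$, (1.4c) $T'=F$. For each of the four choices of distinguished constants $K\in\{\emptyset,\{T,F\},\{U\},\{T,F,U\}\}$, terms are built from countably many variables and the constants in $K$ with $'$, $\wedge$,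 $\vee$, and $\vdash$ denotes derivability in equational logic. Let $E_K$ be, respectively, $\emptyset$, $\{(1.4b),(1.4c)\}$, $\{(1.4a)\}$, $\{(1.4a),(1.4b),(1.4c)\}$. A set $\Gamma$ of equations *completely axiomatises* conditional logic with $K$ distinguished if, for all terms $s,t$, the following are equivalent: $\Gamma\vdash s=t$; the equation $s=t$ is valid in $C$, each constant denoting the corresponding element; and $s=t$ is derivable from (1.1a)–(1.1g) together with $E_K$, under either reading of (1.1e). A set $\Gamma$ of equations is *independent* if no $e\in\Gamma$ is derivable from $\Gamma\setminus\{e\}$. **Theorem.** The Guzmán–Squier axioms (1.1a)–(1.1g) are not independent, under either reading of (1.1e). Moreover: (i) Conditional logic with no distinguished constants is completely axiomatised by $\{(1.1a),(1.1b),(\mathrm{Mem1}),(1.1f),(1.1g)\}$, and this set is independent. (ii) Conditional logic with no distinguished constants is completely axiomatised by $\{(1.1a),(1.1b),(1.1d),(\mathrm{Mem2}),(1.1f),(1.1g)\}$, and this set is independent. (iii) Conditional logic with only $T$ and $F$ distinguished is completely axiomatised by (1.4b), (1.4c) together with the axioms in (i), and also by (1.4b), (1.4c) together with those in (ii). Each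 of these two sets is independent. (iv) Conditional logic with only $U$ distinguished is completely axiomatised by (1.4a) together with the axioms in (i), and also by (1.4a) together with those in (ii). Each of these two sets is independent. (v) Conditional logic with $T$, $F$ and $U$ distinguished is completely axiomatised by (1.4a), (1.4b), (1.4c) together with the axioms in (i), and also by (1.4a), (1.4b), (1.4c) together with those in (ii). Each of these two sets is independent. -/

import Mathlib

namespace CondLogic

/-- The three truth values, i.e. the carrier of the algebra `C`. -/
inductive C : Type
  | T : C
  | F : C
  | U : C

namespace C

/-- Negation `'` on `C`. -/
def neg : C → C
  | T => F
  | F => T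
  | U => U

/-- Conjunction on `C`; the left argument is evaluated first. -/
def and : C → C → C
  | T, y => y
  | F, _ => F
  | U, _ => U

/-- Disjunction on `C`; the left argument is evaluated first. -/
def or : C → C → C
  | T, _ => T
  | F, y => y
  | U, _ => U

end C

/-- Open terms over the operations `'`, `∧`, `∨`, countably many variables, and one constant symbol
for each distinguished truth value, i.e. each element of `K`. -/
inductive Term (K : Set C) : Type
  | var (n : ℕ) : Term K
  | const (c : C) (hc : c ∈ K) : Term K
  | neg (s : Term K) : Term K
  | and (s t : Term K) : Term K
  | or (s t : Term K) : Term K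

namespace Term

/-- Simultaneous substitution of terms for the variables. -/
def subst {K : Set C} (σ : ℕ → Term K) : Term K → Term K
  | var n => σ n
  | const c hc => const c hc
  | neg s => neg (s.subst σ)
  | and s t => and (s.subst σ) (t.subst σ)
  | or s t => or (s.subst σ) (t.subst σ)

/-- The value of a term in the algebra `C` under a valuation of the variables; the constant symbol
of a distinguished truth value denotes this truth value. -/
def eval {K : Set C} (v : ℕ → C) : Term K → C
  | var n => v n
  | const c _ => c
  | neg s => C.neg (s.eval v)
  | and s t => C.and (s.eval v) (t.eval v)
  | or s t => C.or (s.eval v) (t.eval v)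

end Term

/-- An equation `lhs = rhs` between open terms. -/
structure Equation (K : Set C) : Type where
  lhs : Term K
  rhs : Term K

/-- `Derives Γ s t`: the equation `s = t` is derivable from the set of equations `Γ` in equational
logic. -/
inductive Derives {K : Set C} (Γ : Set (Equation K)) : Term K → Term K → Prop
  | ax (e : Equation K) (he : e ∈ Γ) (σ : ℕ → Term K) : Derives Γ (e.lhs.subst σ) (e.rhs.subst σ)
  | refl (s : Term K) : Derives Γ s s
  | symm {s t : Term K} : Derives Γ s t → Derives Γ t s
  | trans {s t u : Term K} : Derives Γ s t → Derives Γ t u → Derives Γ s u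
  | neg {s t : Term K} : Derives Γ s t → Derives Γ s.neg t.neg
  | and {s s₁ t t₁ : Term K} :
      Derives Γ s s₁ → Derives Γ t t₁ → Derives Γ (s.and t) (s₁.and t₁)
  | or {s s₁ t t₁ : Term K} :
      Derives Γ s s₁ → Derives Γ t t₁ → Derives Γ (s.or t) (s₁.or t₁)

/-- Validity of the equation `s = t` in the algebra `C` with the elements of `K` distinguished. -/
def ValidInC {K : Set C} (s t : Term K) : Prop :=
  ∀ v : ℕ → C, s.eval v = t.eval v

/-- No equation of `Γ` is derivable from the other equations of `Γ`. -/
def Independent {K : Set C} (Γ : Set (Equation K)) : Prop :=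
  ∀ e ∈ Γ, ¬ Derives (Γ \ {e}) e.lhs e.rhs

section Axioms

variable {K : Set C}

/-- The variable `x`. -/
def x : Term K := .var 0
/-- The variable `y`. -/
def y : Term K := .var 1
/-- The variable `z`. -/
def z : Term K := .var 2

/-- `x'' = x` -/
def ax1a : Equation K := ⟨x.neg.neg, x⟩

/-- `(x ∧ y)' = x' ∨ y'` -/
def ax1b : Equation K := ⟨(x.and y).neg, x.neg.or y.neg⟩

/-- `(x ∧ y) ∧ z = x ∧ (y ∧ z)` -/
def ax1c : Equation K := ⟨(x.and y).and z, x.and (y.and z)⟩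

/-- `x ∧ (y ∨ z) = (x ∧ y) ∨ (x ∧ z)` -/
def ax1d : Equation K := ⟨x.and (y.or z), (x.and y).or (x.and z)⟩

/-- `(x ∨ y) ∧ z = (x ∧ z) ∨ (x' ∧ (y ∧ z))`, the first reading of axiom (1.1e) -/
def mem1 : Equation K := ⟨(x.or y).and z, (x.and z).or (x.neg.and (y.and z))⟩

/-- `(x ∨ y) ∧ z = (x ∧ z) ∨ ((x' ∧ y) ∧ z)`, the second reading of axiom (1.1e) -/
def mem2 : Equation K := ⟨(x.or y).and z, (x.and z).or ((x.neg.and y).and z)⟩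

/-- `x ∨ (x ∧ y) = x` -/
def ax1f : Equation K := ⟨x.or (x.and y), x⟩

/-- `(x ∧ y) ∨ (y ∧ x) = (y ∧ x) ∨ (x ∧ y)` -/
def ax1g : Equation K := ⟨(x.and y).or (y.and x), (y.and x).or (x.and y)⟩

/-- `U' = U` -/
def ax4a (hU : C.U ∈ K) : Equation K := ⟨(Term.const C.U hU).neg, Term.const C.U hU⟩

/-- `T ∧ x = x` -/
def ax4b (hT : C.T ∈ K) : Equation K := ⟨(Term.const C.T hT).and x, x⟩

/-- `T' = F` -/
def ax4c (hT : C.T ∈ K) (hF : C.F ∈ K) : Equation K :=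
  ⟨(Term.const C.T hT).neg, Term.const C.F hF⟩

end Axioms

/-- The seven Guzmán–Squier axioms (1.1a–g), with (1.1e) read as `mem1`. -/
def guzmanSquier1 (K : Set C) : Set (Equation K) :=
  {ax1a, ax1b, ax1c, ax1d, mem1, ax1f, ax1g}

/-- The seven Guzmán–Squier axioms (1.1a–g), with (1.1e) read as `mem2`. -/
def guzmanSquier2 (K : Set C) : Set (Equation K) :=
  {ax1a, ax1b, ax1c, ax1d, mem2, ax1f, ax1g}

/-- The five axioms (1.1a), (1.1b), (Mem1), (1.1f), (1.1g). -/
def fiveAxioms (K : Set C) : Set (Equation K) :=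
  {ax1a, ax1b, mem1, ax1f, ax1g}

/-- The six axioms (1.1a), (1.1b), (1.1d), (Mem2), (1.1f), (1.1g). -/
def sixAxioms (K : Set C) : Set (Equation K) :=
  {ax1a, ax1b, ax1d, mem2, ax1f, ax1g}

/-- The distinguished constants `T` and `F`. -/
def constTF : Set C := {C.T, C.F}

theorem T_mem_constTF : C.T ∈ constTF := Or.inl rfl

theorem F_mem_constTF : C.F ∈ constTF := Or.inr rfl

/-- The distinguished constant `U`. -/
def constU : Set C := {C.U}

theorem U_mem_constU : C.U ∈ constU := rfl

/-- The axioms (1.4b), (1.4c) for `T` and `F` distinguished. -/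
def axiomsTF : Set (Equation constTF) :=
  {ax4b T_mem_constTF, ax4c T_mem_constTF F_mem_constTF}

/-- The axiom (1.4a) for `U` distinguished. -/
def axiomsU : Set (Equation constU) :=
  {ax4a U_mem_constU}

/-- The axioms (1.4a), (1.4b), (1.4c) for `T`, `F` and `U` distinguished. -/
def axiomsTFU : Set (Equation Set.univ) :=
  {ax4a (Set.mem_univ _), ax4b (Set.mem_univ _), ax4c (Set.mem_univ _) (Set.mem_univ _)}

/-- Conditional logic with the elements of `K` distinguished, where `E` is the set of axioms for
these constants, is completely axiomatised by `Γ`: derivability from `Γ` coincides with validity in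
`C`, and also with derivability from the Guzmán–Squier axioms extended with `E`, under either
reading of (1.1e). -/
def CompletelyAxiomatisesCL {K : Set C} (E Γ : Set (Equation K)) : Prop :=
  ∀ s t : Term K,
    (Derives Γ s t ↔ ValidInC s t) ∧
    (Derives Γ s t ↔ Derives (guzmanSquier1 K ∪ E) s t) ∧
    (Derives Γ s t ↔ Derives (guzmanSquier2 K ∪ E) s t)

end CondLogic

/-! Involution and De Morgan make ∨ definable from negation and ∧, so models of the axioms can be
studied as algebras with these two operations. The equational core is that both axiom sets force ∧
to be associative (`MemAlgebra.inf_assoc`, `DistribAlgebra.inf_assoc`). Associativity makes the two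
readings of the memory law coincide, so every algebra for the six axioms is one for the five.

Completeness is proved by normal forms. Given an element for truth, x = `cond` x T F, and `cond`
commutes with negation and with conjunction on the right; hence every term equals a decision tree
with truth values at its leaves. Trees that agree in C agree in every algebra
(`Tree.ev_eq_of_evC_eq`): if one of them has root n, both are undefined whenever n is, so both can
be expanded by testing n first, and the branches again agree in C and have smaller total size. The
expansion is possible because the elements dom a = a ∨ a' commute with each other
(`MemAlgebra.dom_inf_comm`), so that a definedness test can be moved in front of other tests
(`Tree.dom_inf_ev`). If T and F are not distinguished, truth and falsity are first adjoined to the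
algebra (`WithBounds`). Completeness is this result applied to the terms modulo derivable equality.

Soundness is a finite check in C. Together with completeness it makes all the derivability relations
equal to validity, and it makes associativity redundant in the original axioms. For independence,
each law is refuted in a finite model of all the others; the models interpret all three constants,
so the same ones serve every K. -/

namespace CondLogic

/-! ### Associativity from the five axioms -/

/-- Algebras satisfying the five axioms, presented with negation and conjunction only;
disjunction is definable as `(xᶜ ⊓ yᶜ)ᶜ`. -/
class MemAlgebra (A : Type*) extends Compl A, Min A where
  compl_compl (x : A) : xᶜᶜ = x
  mem (x y z : A) : ((x ⊓ y)ᶜ ⊓ (xᶜ ⊓ (z ⊓ y))ᶜ)ᶜ = (xᶜ ⊓ zᶜ)ᶜ ⊓ y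
  inf_absorb (x y : A) : x ⊓ (xᶜ ⊓ y)ᶜ = x
  compl_inf_comm (x y : A) : (x ⊓ y)ᶜ ⊓ (y ⊓ x)ᶜ = (y ⊓ x)ᶜ ⊓ (x ⊓ y)ᶜ

namespace MemAlgebra

variable {A : Type*} [MemAlgebra A]

/-! The lemmas up to associativity carry names that spell out the operations and the variables of
their left-hand sides in prefix order. -/

/-- Absorption used twice: x' expands to x' ∧ (x'' ∧ x)', and then x absorbs the negation of that.
-/
theorem inf_idem (x : A) : x ⊓ x = x := by
  nth_rw 2 [← compl_compl x]
  rw [← inf_absorb xᶜ x, inf_absorb x (xᶜᶜ ⊓ x)ᶜ]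

theorem inf_compl_inf_compl_inf_compl_inf_xyxzy (x y z : A) :
    (x ⊓ y)ᶜ ⊓ (xᶜ ⊓ (z ⊓ y))ᶜ = ((xᶜ ⊓ zᶜ)ᶜ ⊓ y)ᶜ := by
  rw [← compl_compl ((x ⊓ y)ᶜ ⊓ (xᶜ ⊓ (z ⊓ y))ᶜ), mem x y z]

theorem inf_compl_inf_compl_compl_inf_compl_xxxx (x : A) : (x ⊓ xᶜ)ᶜ ⊓ (xᶜ ⊓ x)ᶜ = (x ⊓ xᶜ)ᶜ := by
  nth_rw 1 [← compl_compl x]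
  rw [← mem xᶜ (xᶜ ⊓ x)ᶜ x, inf_absorb x x]
  nth_rw 3 [← inf_absorb x x]
  nth_rw 1 [← inf_absorb x x]
  rw [mem x (xᶜ ⊓ x)ᶜ x, inf_idem xᶜ]
  nth_rw 1 [compl_compl x]
  rw [inf_absorb x x, compl_compl x, inf_idem x]

theorem inf_compl_inf_inf_compl_compl_inf_xxyxy (x y : A) : x ⊓ (x ⊓ (yᶜ ⊓ (x ⊓ y)ᶜ))ᶜ = x ⊓ y := by
  nth_rw 2 [← compl_compl y]
  nth_rw 2 [← compl_compl x]
  nth_rw 1 [← compl_compl x]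
  nth_rw 1 [← inf_absorb xᶜ yᶜᶜ]
  nth_rw 1 [compl_compl x]
  rw [inf_compl_inf_compl_inf_compl_inf_xyxzy xᶜ (x ⊓ yᶜᶜ)ᶜ yᶜ, compl_compl x,
    inf_idem (x ⊓ yᶜᶜ)ᶜ, compl_compl (x ⊓ yᶜᶜ), compl_compl y]

theorem inf_compl_inf_xxy (x y : A) : xᶜ ⊓ (x ⊓ y) = x ⊓ xᶜ := by
  rw [← inf_compl_inf_inf_compl_compl_inf_xxyxy xᶜ (x ⊓ y),
    inf_compl_inf_compl_inf_compl_inf_xyxzy x y x, inf_idem xᶜ, inf_absorb xᶜ y, compl_compl x,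
    ← compl_compl (xᶜ ⊓ x)]
  nth_rw 2 [← compl_compl x]
  rw [← inf_compl_inf_compl_compl_inf_compl_xxxx xᶜ]
  nth_rw 1 [compl_compl x]
  rw [compl_compl x, compl_inf_comm xᶜ x, inf_compl_inf_compl_compl_inf_compl_xxxx x,
    compl_compl (x ⊓ xᶜ)]

theorem inf_compl_inf_compl_inf_compl_xyxx (x y : A) : (x ⊓ y)ᶜ ⊓ (x ⊓ xᶜ)ᶜ = (x ⊓ y)ᶜ := by
  rw [← inf_compl_inf_xxy x y, inf_compl_inf_compl_inf_compl_inf_xyxzy x y x, inf_idem xᶜ,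
    compl_compl x]

/-- The preceding identities write x ∧ x' as (x ∧ x') ∨ (x' ∧ x), which is symmetric in x and x' by
the commutation axiom. -/
theorem inf_compl_comm (x : A) : x ⊓ xᶜ = xᶜ ⊓ x := by
  rw [← compl_compl (x ⊓ xᶜ), ← inf_compl_inf_compl_compl_inf_compl_xxxx x, ← compl_inf_comm xᶜ x]
  nth_rw 3 [← compl_compl x]
  nth_rw 2 [← compl_compl x]
  rw [inf_compl_inf_compl_compl_inf_compl_xxxx xᶜ, compl_compl x, compl_compl (xᶜ ⊓ x)]

theorem inf_compl_inf (x y : A) : x ⊓ (xᶜ ⊓ y) = x ⊓ xᶜ := by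
  rw [← inf_compl_inf_inf_compl_compl_inf_xxyxy x (xᶜ ⊓ y),
    ← compl_compl ((xᶜ ⊓ y)ᶜ ⊓ (x ⊓ (xᶜ ⊓ y))ᶜ)]
  nth_rw 4 [← compl_compl x]
  rw [mem xᶜ y xᶜ]
  nth_rw 1 [compl_compl x]
  rw [compl_compl x, inf_idem x, inf_absorb x y]

theorem compl_inf_inf_compl_zero (x y : A) : (x ⊓ y)ᶜ ⊓ (xᶜ ⊓ x)ᶜ = (x ⊓ y)ᶜ := by
  rw [← compl_compl (xᶜ ⊓ x)]
  nth_rw 3 [← compl_compl x]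
  rw [← inf_compl_inf_compl_compl_inf_compl_xxxx xᶜ]
  nth_rw 1 [compl_compl x]
  rw [compl_compl x, compl_inf_comm xᶜ x, inf_compl_inf_compl_compl_inf_compl_xxxx x,
    compl_compl (x ⊓ xᶜ), inf_compl_inf_compl_inf_compl_xyxx x y]

theorem inf_compl_inf_compl_inf_compl_xyxx_eq_compl_inf_xy (x y : A) :
    (x ⊓ y)ᶜ ⊓ (x ⊓ xᶜ)ᶜ = (x ⊓ y)ᶜ := by
  rw [inf_compl_comm x, compl_inf_inf_compl_zero x y]

theorem inf_compl_compl_inf_xxy (x y : A) : xᶜ ⊓ (x ⊓ y)ᶜ = xᶜ := by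
  nth_rw 2 [← compl_compl x]
  rw [inf_absorb xᶜ y]

theorem compl_inf_compl_inf_compl_compl_inf_inf_xyxzy (x y z : A) :
    ((xᶜ ⊓ y)ᶜ ⊓ (x ⊓ (z ⊓ y))ᶜ)ᶜ = (x ⊓ zᶜ)ᶜ ⊓ y := by
  rw [← compl_compl x, ← mem xᶜ y z, compl_compl x]

theorem inf_compl_inf_xxy_eq_inf_compl_xx (x y : A) : xᶜ ⊓ (x ⊓ y) = x ⊓ xᶜ := by
  nth_rw 2 [← compl_compl x]
  rw [inf_compl_inf xᶜ y, compl_compl x, ← inf_compl_comm x]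

theorem inf_inf_compl_xxx (x : A) : x ⊓ (x ⊓ xᶜ) = x ⊓ xᶜ := by
  nth_rw 1 [inf_compl_comm x]
  rw [inf_compl_inf x x]

theorem inf_compl_inf_compl_xxx (x : A) : (x ⊓ xᶜ)ᶜ ⊓ x = x := by
  nth_rw 3 [← compl_compl x]
  rw [inf_compl_comm x]
  nth_rw 2 [← compl_compl x]
  rw [← mem x xᶜᶜ xᶜ, inf_inf_compl_xxx xᶜ]
  nth_rw 1 [compl_compl x]
  rw [inf_idem x, compl_compl x, ← inf_compl_comm x, inf_compl_compl_inf_xxy x xᶜ, compl_compl x]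

theorem inf_compl_inf_compl_compl_xxx (x : A) : (x ⊓ xᶜ)ᶜ ⊓ xᶜ = xᶜ := by
  rw [← compl_inf_compl_inf_compl_compl_inf_inf_xyxzy x xᶜ x, inf_inf_compl_xxx x, inf_idem xᶜ,
    compl_compl x, inf_compl_comm x, inf_absorb x x]

theorem inf_inf_compl_compl_inf_compl_xxxx (x : A) : (x ⊓ xᶜ) ⊓ (x ⊓ xᶜ)ᶜ = x ⊓ xᶜ := by
  rw [← inf_inf_compl_xxx (x ⊓ xᶜ)]
  nth_rw 1 [← inf_inf_compl_xxx x]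
  rw [inf_compl_comm (x ⊓ xᶜ)]
  nth_rw 2 [inf_compl_comm x]
  nth_rw 5 [← compl_compl x]
  rw [← mem x (x ⊓ xᶜ) xᶜ, inf_absorb (x ⊓ (x ⊓ xᶜ)) (xᶜ ⊓ (xᶜ ⊓ (x ⊓ xᶜ)))ᶜ, inf_inf_compl_xxx x]

theorem inf_inf_compl_inf_xxxy (x y : A) : (x ⊓ xᶜ) ⊓ (x ⊓ y) = x ⊓ xᶜ := by
  nth_rw 1 [← inf_compl_inf_xxy_eq_inf_compl_xx x y]
  rw [← compl_compl ((xᶜ ⊓ (x ⊓ y)) ⊓ (x ⊓ y)),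
    ← inf_compl_inf_compl_inf_compl_xyxx_eq_compl_inf_xy (xᶜ ⊓ (x ⊓ y)) (x ⊓ y)]
  nth_rw 1 [← compl_compl (xᶜ ⊓ (x ⊓ y))]
  rw [inf_compl_comm (xᶜ ⊓ (x ⊓ y)),
    compl_inf_compl_inf_compl_compl_inf_inf_xyxzy (xᶜ ⊓ (x ⊓ y))ᶜ (x ⊓ y) xᶜ,
    inf_compl_inf_xxy_eq_inf_compl_xx x y, compl_compl x, inf_compl_inf_compl_xxx x,
    inf_compl_inf_xxy_eq_inf_compl_xx x y]

theorem inf_compl_inf_compl_inf_xxxy (x y : A) : (x ⊓ xᶜ)ᶜ ⊓ (x ⊓ y) = x ⊓ (x ⊓ y) := by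
  nth_rw 3 [← compl_compl x]
  rw [inf_compl_comm x]
  nth_rw 2 [← compl_compl x]
  rw [← mem x (xᶜᶜ ⊓ y) xᶜ, inf_compl_inf xᶜ y, inf_inf_compl_xxx xᶜ]
  nth_rw 1 [compl_compl x]
  rw [compl_compl x, ← inf_compl_comm x,
    inf_compl_inf_compl_inf_compl_xyxx_eq_compl_inf_xy x (x ⊓ y), compl_compl (x ⊓ (x ⊓ y))]

theorem inf_compl_inf_compl_inf_xxxy_eq_inf_inf_xxy (x y : A) :
    x ⊓ (x ⊓ (x ⊓ y)ᶜ)ᶜ = x ⊓ (x ⊓ y) := by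
  rw [← compl_compl (x ⊓ (x ⊓ (x ⊓ y)ᶜ)ᶜ)]
  nth_rw 2 [← compl_compl x]
  nth_rw 1 [← compl_compl x]
  nth_rw 1 [← inf_compl_compl_inf_xxy x xᶜ]
  rw [← inf_compl_inf_compl_inf_compl_xyxx_eq_compl_inf_xy x y, mem xᶜ (x ⊓ xᶜ)ᶜ (x ⊓ y)ᶜ,
    compl_compl (x ⊓ y), compl_compl x,
    inf_compl_inf_compl_inf_compl_xyxx_eq_compl_inf_xy x (x ⊓ y), compl_compl (x ⊓ (x ⊓ y))]

theorem inf_compl_inf_compl_inf_compl_compl_inf_inf_xxxyxy (x y : A) :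
    ((x ⊓ xᶜ)ᶜ ⊓ (x ⊓ y)ᶜ)ᶜ ⊓ (x ⊓ y) = (x ⊓ y) ⊓ ((x ⊓ xᶜ)ᶜ ⊓ (x ⊓ y)ᶜ)ᶜ := by
  nth_rw 2 [← compl_compl (x ⊓ y)]
  nth_rw 2 [← inf_compl_inf_compl_inf_compl_xyxx_eq_compl_inf_xy x y]
  rw [← compl_inf_comm (x ⊓ y)ᶜ (x ⊓ xᶜ)ᶜ,
    inf_compl_inf_compl_inf_compl_xyxx_eq_compl_inf_xy x y, compl_compl (x ⊓ y)]

theorem inf_inf_inf_compl_inf_compl_xxyxx (x y : A) : ((x ⊓ xᶜ) ⊓ y) ⊓ (x ⊓ xᶜ) = x ⊓ xᶜ := by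
  nth_rw 2 [← compl_compl (x ⊓ xᶜ)]
  rw [← inf_compl_compl_inf_xxy (x ⊓ xᶜ) y]
  nth_rw 2 [← inf_inf_compl_compl_inf_compl_xxxx x]
  rw [← inf_compl_inf_compl_inf_compl_compl_inf_inf_xxxyxy (x ⊓ xᶜ) y,
    inf_inf_compl_compl_inf_compl_xxxx x, inf_compl_compl_inf_xxy (x ⊓ xᶜ) y,
    compl_compl (x ⊓ xᶜ)]
  nth_rw 1 [← inf_inf_compl_compl_inf_compl_xxxx x]
  rw [inf_inf_compl_inf_xxxy (x ⊓ xᶜ) y, inf_inf_compl_compl_inf_compl_xxxx x]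

theorem inf_compl_inf_inf_compl_compl_inf_compl_xxyxx (x y : A) :
    ((x ⊓ xᶜ) ⊓ yᶜ)ᶜ ⊓ (x ⊓ xᶜ) = x ⊓ xᶜ := by
  nth_rw 1 [← compl_compl (x ⊓ xᶜ)]
  rw [← mem (x ⊓ xᶜ)ᶜ (x ⊓ xᶜ) y, ← inf_compl_comm (x ⊓ xᶜ), compl_compl (x ⊓ xᶜ),
    inf_inf_compl_compl_inf_compl_xxxx x, inf_compl_compl_inf_xxy (x ⊓ xᶜ) (y ⊓ (x ⊓ xᶜ)),
    compl_compl (x ⊓ xᶜ)]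

theorem inf_compl_inf_compl_compl_inf_inf_xxxxy (x y : A) :
    (x ⊓ xᶜ)ᶜ ⊓ (x ⊓ (x ⊓ y))ᶜ = (x ⊓ y)ᶜ := by
  rw [← inf_inf_inf_compl_inf_compl_xxyxx x yᶜᶜ]
  nth_rw 2 [← inf_inf_compl_compl_inf_compl_xxxx x]
  rw [← inf_compl_inf_xxy_eq_inf_compl_xx (x ⊓ xᶜ) yᶜᶜ]
  nth_rw 2 [← inf_compl_inf_inf_compl_compl_inf_compl_xxyxx x yᶜ]
  nth_rw 3 [← compl_compl (x ⊓ xᶜ)]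
  nth_rw 1 [← inf_idem ((x ⊓ xᶜ) ⊓ yᶜᶜ)]
  rw [← mem ((x ⊓ xᶜ) ⊓ yᶜᶜ) ((x ⊓ xᶜ) ⊓ yᶜᶜ) (x ⊓ xᶜ)ᶜ,
    inf_absorb (((x ⊓ xᶜ) ⊓ yᶜᶜ) ⊓ ((x ⊓ xᶜ) ⊓ yᶜᶜ)) (((x ⊓ xᶜ) ⊓ yᶜᶜ)ᶜ ⊓ ((x ⊓ xᶜ)ᶜ ⊓ ((x ⊓ xᶜ) ⊓ yᶜᶜ)))ᶜ,
    inf_idem ((x ⊓ xᶜ) ⊓ yᶜᶜ), compl_compl y, ← compl_compl (x ⊓ xᶜ),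
    ← inf_compl_inf_compl_inf_xxxy x y,
    ← compl_compl (((x ⊓ xᶜ)ᶜᶜ ⊓ y)ᶜ ⊓ ((x ⊓ xᶜ)ᶜ ⊓ (x ⊓ y))ᶜ),
    compl_inf_compl_inf_compl_compl_inf_inf_xyxzy (x ⊓ xᶜ)ᶜ y x, inf_compl_inf_compl_compl_xxx x,
    compl_compl x]

theorem compl_inf_inf_xxy (x y : A) : (x ⊓ (x ⊓ y))ᶜ = (x ⊓ y)ᶜ := by
  rw [← inf_compl_inf_compl_inf_xxxy_eq_inf_inf_xxy x y]
  nth_rw 1 [← inf_compl_inf_compl_compl_inf_inf_xxxxy x y]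
  nth_rw 2 [← compl_compl x]
  nth_rw 1 [← compl_compl x]
  nth_rw 1 [← inf_compl_compl_inf_xxy x (x ⊓ y)]
  rw [mem xᶜ (x ⊓ (x ⊓ y))ᶜ (x ⊓ xᶜ)ᶜ, compl_compl x, compl_compl (x ⊓ xᶜ), inf_inf_compl_xxx x,
    inf_compl_inf_compl_compl_inf_inf_xxxxy x y]

/-- Put e = x ∧ x' and w = e ∧ y. Absorption followed by the memory law gives w = w ∧ ((w' ∧ e)' ∧
w). Since w' ∧ e = e, this is w ∧ (e' ∧ w) = w ∧ (e ∧ e') = w ∧ e = e. -/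
theorem inf_compl_self_inf (x y : A) : (x ⊓ xᶜ) ⊓ y = x ⊓ xᶜ := by
  rw [← compl_compl y, ← inf_idem ((x ⊓ xᶜ) ⊓ yᶜᶜ),
    ← inf_absorb (((x ⊓ xᶜ) ⊓ yᶜᶜ) ⊓ ((x ⊓ xᶜ) ⊓ yᶜᶜ)) (((x ⊓ xᶜ) ⊓ yᶜᶜ)ᶜ ⊓ ((x ⊓ xᶜ)ᶜ ⊓ ((x ⊓ xᶜ) ⊓ yᶜᶜ)))ᶜ,
    mem ((x ⊓ xᶜ) ⊓ yᶜᶜ) ((x ⊓ xᶜ) ⊓ yᶜᶜ) (x ⊓ xᶜ)ᶜ, inf_idem ((x ⊓ xᶜ) ⊓ yᶜᶜ),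
    compl_compl (x ⊓ xᶜ), inf_compl_inf_inf_compl_compl_inf_compl_xxyxx x yᶜ,
    inf_compl_inf_xxy_eq_inf_compl_xx (x ⊓ xᶜ) yᶜᶜ, inf_inf_compl_compl_inf_compl_xxxx x,
    inf_inf_inf_compl_inf_compl_xxyxx x yᶜᶜ]

theorem inf_inf_self_left (x y : A) : x ⊓ (x ⊓ y) = x ⊓ y := by
  rw [← compl_compl (x ⊓ (x ⊓ y)), compl_inf_inf_xxy x y, compl_compl (x ⊓ y)]

theorem inf_compl_inf_xxy_eq_inf_compl_xx_alt (x y : A) : xᶜ ⊓ (x ⊓ y) = x ⊓ xᶜ := by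
  nth_rw 2 [← compl_compl x]
  rw [inf_compl_inf xᶜ y, compl_compl x, ← inf_compl_comm x]

theorem inf_inf_inf_inf_xyxxy (x y : A) : ((x ⊓ y) ⊓ x) ⊓ (x ⊓ y) = (x ⊓ y) ⊓ x := by
  nth_rw 2 [← compl_compl (x ⊓ y)]
  rw [← inf_absorb (x ⊓ y)ᶜ x, compl_compl (x ⊓ y)]
  nth_rw 2 [← inf_inf_self_left x y]
  rw [← compl_inf_comm (x ⊓ y) x, inf_absorb ((x ⊓ y) ⊓ x) (x ⊓ (x ⊓ y))ᶜ]

theorem inf_compl_inf_compl_xxx_eq_x (x : A) : (x ⊓ xᶜ)ᶜ ⊓ x = x := by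
  rw [inf_compl_comm x]
  nth_rw 2 [← compl_compl x]
  rw [← mem x x xᶜ, inf_idem x, ← inf_compl_comm x, inf_compl_inf_xxy_eq_inf_compl_xx_alt x xᶜ]
  nth_rw 2 [← compl_compl x]
  rw [inf_absorb xᶜ xᶜ, compl_compl x]

theorem inf_compl_inf_compl_inf_xxxy_eq_inf_xy (x y : A) : (x ⊓ xᶜ)ᶜ ⊓ (x ⊓ y) = x ⊓ y := by
  nth_rw 3 [← compl_compl x]
  rw [inf_compl_comm x]
  nth_rw 2 [← compl_compl x]
  rw [← mem x (xᶜᶜ ⊓ y) xᶜ, inf_compl_inf xᶜ y, inf_inf_self_left xᶜ xᶜᶜ]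
  nth_rw 1 [compl_compl x]
  rw [inf_inf_self_left x y, compl_compl x, compl_inf_inf_compl_zero x y, compl_compl (x ⊓ y)]

theorem compl_inf_compl_inf_compl_compl_inf_xxxy (x y : A) : ((x ⊓ xᶜ)ᶜ ⊓ (x ⊓ y)ᶜ)ᶜ = x ⊓ y := by
  rw [← inf_compl_self_inf x y, ← compl_compl (x ⊓ xᶜ)]
  nth_rw 1 [← inf_compl_inf_compl_inf_xxxy_eq_inf_xy x y]
  nth_rw 2 [← compl_compl (x ⊓ xᶜ)ᶜ]
  rw [mem (x ⊓ xᶜ)ᶜᶜ y x, compl_compl (x ⊓ xᶜ)ᶜ, inf_compl_comm x]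
  nth_rw 2 [← compl_compl x]
  rw [inf_compl_inf_compl_xxx_eq_x xᶜ, compl_compl x]

theorem inf_compl_inf_xyx (x y : A) : (x ⊓ y)ᶜ ⊓ x = x ⊓ (yᶜ ⊓ x) := by
  nth_rw 1 [← compl_compl y]
  nth_rw 1 [← compl_compl x]
  rw [← mem xᶜ x yᶜ, ← inf_compl_comm x, compl_compl x,
    compl_inf_compl_inf_compl_compl_inf_xxxy x (yᶜ ⊓ x)]

theorem inf_inf_compl_inf_compl_xyxx (x y : A) : x ⊓ ((yᶜ ⊓ x)ᶜ ⊓ x) = (x ⊓ y) ⊓ x := by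
  rw [← compl_compl (x ⊓ y), ← compl_inf_inf_compl_zero x y, ← inf_compl_comm x,
    ← mem (x ⊓ y) x (x ⊓ xᶜ), inf_compl_self_inf x x, inf_compl_comm x, mem (x ⊓ y) x xᶜ,
    compl_compl x, inf_compl_inf_xyx x y, inf_compl_inf_xyx x (yᶜ ⊓ x)]

theorem inf_inf_self (x y : A) : (x ⊓ y) ⊓ x = x ⊓ y := by
  rw [← inf_inf_inf_inf_xyxxy x y]
  nth_rw 3 [← compl_compl x]
  nth_rw 1 [← compl_compl x]
  rw [← inf_inf_compl_inf_compl_xyxx (xᶜᶜ ⊓ y) x, inf_compl_inf xᶜ y]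
  nth_rw 1 [compl_compl x]
  nth_rw 1 [compl_compl x]
  rw [← inf_compl_comm x, compl_compl x, inf_compl_inf_compl_inf_xxxy_eq_inf_xy x y,
    inf_idem (x ⊓ y)]

theorem compl_inf_compl_inf_compl_compl_inf_inf_xyxzy_eq_inf_compl_inf_compl_xzy (x y z : A) :
    ((xᶜ ⊓ y)ᶜ ⊓ (x ⊓ (z ⊓ y))ᶜ)ᶜ = (x ⊓ zᶜ)ᶜ ⊓ y := by
  rw [← compl_compl x, ← mem xᶜ y z, compl_compl x]

theorem inf_compl_compl_inf_xxy_eq_compl_x (x y : A) : xᶜ ⊓ (x ⊓ y)ᶜ = xᶜ := by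
  nth_rw 2 [← compl_compl x]
  rw [inf_absorb xᶜ y]

theorem inf_compl_inf_xxy_eq_inf_compl_xx_alt_alt (x y : A) : xᶜ ⊓ (x ⊓ y) = x ⊓ xᶜ := by
  nth_rw 2 [← compl_compl x]
  rw [inf_compl_inf xᶜ y, compl_compl x, ← inf_compl_comm x]

theorem inf_inf_inf_compl_inf_compl_xyxxy (x y : A) : (x ⊓ y) ⊓ ((x ⊓ xᶜ)ᶜ ⊓ y) = x ⊓ y := by
  rw [inf_compl_comm x]
  nth_rw 3 [← compl_compl x]
  rw [← mem x y xᶜ, inf_absorb (x ⊓ y) (xᶜ ⊓ (xᶜ ⊓ y))ᶜ]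

theorem inf_compl_inf_compl_compl_xxx_eq_compl_x (x : A) : (x ⊓ xᶜ)ᶜ ⊓ xᶜ = xᶜ := by
  rw [inf_compl_comm x]
  nth_rw 2 [← compl_compl x]
  rw [inf_compl_comm xᶜ]
  nth_rw 2 [← compl_compl xᶜ]
  rw [← mem xᶜ xᶜ xᶜᶜ, inf_idem xᶜ, ← inf_compl_comm xᶜ,
    inf_compl_inf_xxy_eq_inf_compl_xx_alt_alt xᶜ xᶜᶜ, inf_compl_compl_inf_xxy_eq_compl_x xᶜ xᶜᶜ,
    compl_compl xᶜ]

theorem inf_compl_inf_compl_inf_xxxy_eq_inf_xy_alt (x y : A) : x ⊓ (x ⊓ (x ⊓ y)ᶜ)ᶜ = x ⊓ y := by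
  rw [← compl_compl (x ⊓ (x ⊓ (x ⊓ y)ᶜ)ᶜ)]
  nth_rw 2 [← compl_compl x]
  nth_rw 1 [← compl_compl x]
  nth_rw 1 [← inf_compl_compl_inf_xxy_eq_compl_x x y]
  nth_rw 2 [← inf_idem (x ⊓ y)ᶜ]
  rw [mem xᶜ (x ⊓ y)ᶜ (x ⊓ y)ᶜ, compl_compl x, compl_compl (x ⊓ y), inf_inf_self_left x y,
    inf_idem (x ⊓ y)ᶜ, compl_compl (x ⊓ y)]

theorem inf_compl_inf_compl_inf_xxxy_eq_inf_xy_alt_alt (x y : A) : (x ⊓ xᶜ)ᶜ ⊓ (x ⊓ y) = x ⊓ y := by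
  nth_rw 3 [← compl_compl x]
  rw [inf_compl_comm x]
  nth_rw 2 [← compl_compl x]
  rw [← mem x (xᶜᶜ ⊓ y) xᶜ, inf_compl_inf xᶜ y, inf_inf_self_left xᶜ xᶜᶜ]
  nth_rw 1 [compl_compl x]
  rw [inf_inf_self_left x y, compl_compl x, compl_inf_inf_compl_zero x y, compl_compl (x ⊓ y)]

theorem inf_compl_inf_compl_inf_compl_xxxy (x y : A) : (x ⊓ xᶜ)ᶜ ⊓ (xᶜ ⊓ y) = xᶜ ⊓ y := by
  rw [inf_compl_comm x]
  nth_rw 2 [← compl_compl x]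
  rw [inf_compl_inf_compl_inf_xxxy_eq_inf_xy_alt_alt xᶜ y]

theorem inf_compl_inf_compl_xyx (x y : A) : (x ⊓ yᶜ)ᶜ ⊓ x = x ⊓ (y ⊓ x) := by
  nth_rw 1 [← compl_compl x]
  rw [← mem xᶜ x y, ← inf_compl_comm x, compl_compl x, ← inf_compl_self_inf x (y ⊓ x),
    ← compl_compl (x ⊓ xᶜ)]
  nth_rw 1 [← inf_compl_inf_compl_inf_xxxy_eq_inf_xy_alt_alt x (y ⊓ x)]
  rw [
    compl_inf_compl_inf_compl_compl_inf_inf_xyxzy_eq_inf_compl_inf_compl_xzy (x ⊓ xᶜ)ᶜ (y ⊓ x) x,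
    inf_compl_inf_compl_compl_xxx_eq_compl_x x, compl_compl x]

theorem inf_compl_inf_xxy_eq_inf_inf_compl_xyx (x y : A) : x ⊓ (x ⊓ y)ᶜ = x ⊓ (yᶜ ⊓ x) := by
  rw [← inf_inf_self_left x (x ⊓ y)ᶜ, ← inf_inf_self x (x ⊓ y)ᶜ,
    ← inf_compl_inf_compl_xyx x (x ⊓ (x ⊓ y)ᶜ), inf_compl_inf_compl_inf_xxxy_eq_inf_xy_alt x y]
  nth_rw 1 [← compl_compl y]
  rw [inf_compl_inf_compl_xyx x yᶜ]

theorem inf_inf_compl_inf_xyxx (x y : A) : x ⊓ ((y ⊓ x)ᶜ ⊓ x) = x ⊓ yᶜ := by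
  rw [← inf_compl_inf_compl_inf_xxxy_eq_inf_xy_alt x yᶜ,
    inf_compl_inf_xxy_eq_inf_inf_compl_xyx x yᶜ,
    inf_compl_inf_xxy_eq_inf_inf_compl_xyx x (yᶜᶜ ⊓ x), compl_compl y]

/-- With e = x ∧ x' this says e ∨ (x ∧ y) = x ∧ y. As e ∧ y = e and e' ∧ (x ∧ y) = x ∧ y, the left
side is the memory expansion of (e ∨ x) ∧ y, and e ∨ x = x. -/
theorem inf_compl_inf_compl_compl_inf_xxxy (x y : A) : (x ⊓ xᶜ)ᶜ ⊓ (x ⊓ y)ᶜ = (x ⊓ y)ᶜ := by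
  rw [← inf_compl_self_inf x y]
  nth_rw 1 [← inf_compl_inf_compl_inf_xxxy_eq_inf_xy_alt_alt x y]
  rw [← compl_compl (((x ⊓ xᶜ) ⊓ y)ᶜ ⊓ ((x ⊓ xᶜ)ᶜ ⊓ (x ⊓ y))ᶜ), mem (x ⊓ xᶜ) y x,
    inf_compl_inf_compl_compl_xxx_eq_compl_x x, compl_compl x]

theorem inf_compl_inf_compl_xxy (x y : A) : (x ⊓ xᶜ)ᶜ ⊓ y = (xᶜ ⊓ yᶜ)ᶜ ⊓ y := by
  rw [← mem x y y, inf_idem y, ← inf_inf_self_left xᶜ y, mem x y xᶜ, compl_compl x,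
    ← inf_compl_comm x]

theorem inf_inf_compl_xyy (x y : A) : x ⊓ (y ⊓ yᶜ) = x ⊓ (yᶜ ⊓ xᶜ) := by
  rw [← compl_compl (y ⊓ yᶜ), ← inf_inf_compl_inf_xyxx x (y ⊓ yᶜ)ᶜ, inf_compl_inf_compl_xxy y x,
    inf_inf_compl_inf_xyxx x (yᶜ ⊓ xᶜ)ᶜ, compl_compl (yᶜ ⊓ xᶜ)]

theorem inf_compl_inf_compl_xyx_eq_inf_compl_inf_xyx (x y : A) : xᶜ ⊓ (yᶜ ⊓ x) = xᶜ ⊓ (y ⊓ x) := by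
  nth_rw 2 [← compl_compl x]
  rw [← inf_inf_compl_xyy xᶜ y, inf_compl_comm y]
  nth_rw 2 [← compl_compl y]
  rw [inf_inf_compl_xyy xᶜ yᶜ, compl_compl y, compl_compl x]

theorem inf_compl_inf_compl_xyy (x y : A) : (x ⊓ yᶜ)ᶜ ⊓ y = (x ⊓ xᶜ)ᶜ ⊓ y := by
  rw [← compl_compl x, ← inf_compl_inf_compl_xxy xᶜ y, compl_compl x, ← inf_compl_comm x]

theorem inf_compl_inf_compl_inf_xyxz (x y z : A) : (x ⊓ yᶜ)ᶜ ⊓ (x ⊓ z) = x ⊓ (y ⊓ (x ⊓ z)) := by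
  nth_rw 2 [← compl_compl x]
  rw [← compl_inf_compl_inf_compl_compl_inf_inf_xyxzy_eq_inf_compl_inf_compl_xzy x (xᶜᶜ ⊓ z) y,
    inf_compl_inf xᶜ z]
  nth_rw 1 [compl_compl x]
  rw [← inf_compl_comm x, compl_compl x, inf_compl_inf_compl_compl_inf_xxxy x (y ⊓ (x ⊓ z)),
    compl_compl (x ⊓ (y ⊓ (x ⊓ z)))]

theorem inf_inf_compl_inf_compl_xyxx_eq_inf_inf_xyx (x y : A) :
    x ⊓ (y ⊓ (x ⊓ xᶜ)ᶜ) = x ⊓ (y ⊓ x) := by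
  rw [← compl_compl (y ⊓ (x ⊓ xᶜ)ᶜ), ← inf_inf_compl_inf_xyxx x (y ⊓ (x ⊓ xᶜ)ᶜ)ᶜ,
    ← compl_inf_compl_inf_compl_compl_inf_inf_xyxzy_eq_inf_compl_inf_compl_xzy y x (x ⊓ xᶜ),
    inf_compl_self_inf x x, inf_compl_comm x,
    compl_inf_compl_inf_compl_compl_inf_inf_xyxzy_eq_inf_compl_inf_compl_xzy y x xᶜ,
    compl_compl x, inf_inf_compl_inf_xyxx x (y ⊓ x)ᶜ, compl_compl (y ⊓ x)]

theorem inf_compl_inf_compl_compl_xyx (x y : A) : (x ⊓ yᶜ)ᶜ ⊓ xᶜ = (x ⊓ y)ᶜ ⊓ xᶜ := by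
  nth_rw 1 [← compl_compl x]
  rw [← mem xᶜ xᶜ y]
  nth_rw 1 [← compl_compl xᶜ]
  rw [← inf_compl_inf_compl_xyx_eq_inf_compl_inf_xyx xᶜ y,
    compl_inf_compl_inf_compl_compl_inf_inf_xyxzy_eq_inf_compl_inf_compl_xzy xᶜᶜ xᶜ yᶜ,
    compl_compl y, compl_compl x]

theorem compl_inf_compl_inf_compl_compl_inf_xyxz (x y z : A) :
    ((x ⊓ yᶜ)ᶜ ⊓ (x ⊓ z)ᶜ)ᶜ = x ⊓ ((y ⊓ (x ⊓ z)ᶜ)ᶜ ⊓ x) := by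
  nth_rw 1 [← compl_compl x]
  rw [← mem xᶜ (x ⊓ z)ᶜ y, compl_compl ((xᶜ ⊓ (x ⊓ z)ᶜ)ᶜ ⊓ (xᶜᶜ ⊓ (y ⊓ (x ⊓ z)ᶜ))ᶜ),
    inf_compl_compl_inf_xxy_eq_compl_x x z]
  nth_rw 1 [compl_compl x]
  rw [compl_compl x, inf_compl_inf_xxy_eq_inf_inf_compl_xyx x (y ⊓ (x ⊓ z)ᶜ)]

theorem inf_inf_inf_compl_inf_compl_xxxyx (x y : A) : x ⊓ (((x ⊓ xᶜ)ᶜ ⊓ y) ⊓ x) = x ⊓ y := by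
  rw [← inf_compl_inf_compl_xyy x y,
    ← compl_inf_compl_inf_compl_compl_inf_inf_xyxzy_eq_inf_compl_inf_compl_xzy x y y, inf_idem y,
    ← compl_inf_compl_inf_compl_compl_inf_xyxz x (xᶜ ⊓ y)ᶜ y, compl_compl (xᶜ ⊓ y),
    inf_compl_inf x y, inf_compl_inf_compl_compl_inf_xxxy x y, compl_compl (x ⊓ y)]

theorem inf_inf_compl_inf_compl_xxxy (x y : A) : x ⊓ ((x ⊓ xᶜ)ᶜ ⊓ y) = x ⊓ y := by
  rw [← inf_inf_inf_compl_inf_compl_xxxyx x ((x ⊓ xᶜ)ᶜ ⊓ y), inf_inf_self_left (x ⊓ xᶜ)ᶜ y,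
    inf_inf_inf_compl_inf_compl_xxxyx x y]

theorem inf_inf_compl_inf_compl_xxyy (x y : A) : x ⊓ ((x ⊓ y)ᶜ ⊓ yᶜ) = x ⊓ yᶜ := by
  rw [← inf_inf_compl_inf_compl_xxxy x yᶜ, ← inf_compl_inf_compl_xyy x yᶜ, compl_compl y]

theorem inf_compl_inf_compl_inf_compl_xxyy (x y : A) : xᶜ ⊓ ((x ⊓ yᶜ)ᶜ ⊓ y) = xᶜ ⊓ y := by
  rw [inf_compl_inf_compl_xyy x y, inf_compl_inf_compl_xxy x y,
    ← inf_compl_inf_compl_inf_compl_xxxy x ((xᶜ ⊓ yᶜ)ᶜ ⊓ y), inf_compl_inf_compl_xyy xᶜ y,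
    inf_inf_compl_inf_compl_xxxy xᶜ y, inf_compl_inf_compl_inf_compl_xxxy x y]

theorem inf_inf_xyy (x y : A) : (x ⊓ y) ⊓ y = x ⊓ y := by
  nth_rw 1 [← compl_compl (x ⊓ y)]
  nth_rw 1 [← compl_compl y]
  rw [← inf_compl_inf_compl_inf_compl_xxyy (x ⊓ yᶜᶜ)ᶜ y, inf_compl_inf_compl_xyy x yᶜ,
    compl_compl y, compl_compl (x ⊓ y), ← inf_compl_inf_compl_xxy (x ⊓ xᶜ) y,
    ← inf_compl_inf_compl_xyy (x ⊓ xᶜ) y, inf_compl_self_inf x yᶜ,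
    inf_inf_inf_compl_inf_compl_xyxxy x y]

theorem inf_compl_inf_compl_inf_compl_xyxy (x y : A) : ((x ⊓ y)ᶜ ⊓ xᶜ)ᶜ ⊓ y = x ⊓ y := by
  rw [← compl_inf_compl_inf_compl_compl_inf_inf_xyxzy_eq_inf_compl_inf_compl_xzy (x ⊓ y)ᶜ y x,
    ← inf_compl_comm (x ⊓ y), compl_compl (x ⊓ y), inf_compl_comm (x ⊓ y),
    compl_inf_inf_compl_zero (x ⊓ y) y, compl_compl ((x ⊓ y) ⊓ y), inf_inf_xyy x y]

theorem inf_inf_inf_xyxy (x y : A) : x ⊓ (y ⊓ (x ⊓ y)) = x ⊓ y := by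
  rw [← inf_compl_inf_compl_inf_xyxz x y y]
  nth_rw 2 [← compl_compl y]
  rw [← inf_inf_compl_inf_compl_xxyy x yᶜ, ← inf_compl_inf_compl_inf_xyxz (x ⊓ yᶜ)ᶜ x yᶜᶜ,
    ← inf_compl_inf_compl_compl_xyx x yᶜ, ← inf_inf_compl_inf_compl_xxyy x yᶜ,
    inf_compl_inf_compl_inf_compl_xyxy x ((x ⊓ yᶜ)ᶜ ⊓ yᶜᶜ), inf_inf_compl_inf_compl_xxyy x yᶜ,
    compl_compl y]

theorem inf_compl_inf_xyx_eq_inf_compl_xy (x y : A) : (x ⊓ y)ᶜ ⊓ x = x ⊓ yᶜ := by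
  rw [← inf_inf_inf_compl_inf_compl_xxxyx x yᶜ, ← inf_inf_inf_xyxy (x ⊓ xᶜ)ᶜ yᶜ,
    inf_inf_inf_compl_inf_compl_xxxyx x (yᶜ ⊓ ((x ⊓ xᶜ)ᶜ ⊓ yᶜ)), ← inf_compl_self_inf x yᶜ,
    inf_inf_compl_inf_xyxx yᶜ (x ⊓ xᶜ), inf_inf_compl_inf_compl_xyxx_eq_inf_inf_xyx x yᶜ,
    ← inf_compl_inf_compl_xyx x yᶜ, compl_compl y]

theorem inf_compl_inf_compl_compl_inf_inf_xxxyz (x y z : A) :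
    (x ⊓ xᶜ)ᶜ ⊓ ((x ⊓ y) ⊓ z)ᶜ = (x ⊓ ((x ⊓ y) ⊓ z))ᶜ := by
  nth_rw 1 [← compl_compl (x ⊓ y)]
  nth_rw 3 [← compl_compl x]
  rw [← inf_compl_inf_xxy_eq_inf_compl_xx_alt_alt x y]
  nth_rw 1 [← compl_compl (x ⊓ y)]
  nth_rw 2 [← compl_compl x]
  rw [← mem x ((xᶜᶜ ⊓ y)ᶜᶜ ⊓ z)ᶜ (xᶜᶜ ⊓ y)ᶜ, inf_absorb (xᶜᶜ ⊓ y)ᶜ z, inf_absorb xᶜ y]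
  nth_rw 1 [compl_compl x]
  rw [compl_compl (x ⊓ y), compl_compl x, inf_compl_inf_xyx_eq_inf_compl_xy x ((x ⊓ y) ⊓ z)ᶜ,
    compl_compl ((x ⊓ y) ⊓ z)]

/-- Let w = (x ∧ y) ∧ z and e = x ∧ x'. Then x ∧ w = (x ∧ w) ∧ w = (e ∨ w) ∧ w. In the memory
expansion of this, w ∧ w may be read as (x ∧ y) ∧ w, which turns it into the expansion of (e ∨ (x ∧
y)) ∧ w = (x ∧ y) ∧ w = w. -/
theorem inf_inf_inf_xxyz (x y z : A) : x ⊓ ((x ⊓ y) ⊓ z) = (x ⊓ y) ⊓ z := by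
  rw [← inf_inf_xyy x ((x ⊓ y) ⊓ z), ← compl_compl (x ⊓ ((x ⊓ y) ⊓ z)),
    ← inf_compl_inf_compl_compl_inf_inf_xxxyz x y z,
    ← compl_inf_compl_inf_compl_compl_inf_inf_xyxzy_eq_inf_compl_inf_compl_xzy (x ⊓ xᶜ)ᶜ ((x ⊓ y) ⊓ z) ((x ⊓ y) ⊓ z),
    inf_idem ((x ⊓ y) ⊓ z)]
  nth_rw 2 [← inf_inf_self_left (x ⊓ y) z]
  rw [
    compl_inf_compl_inf_compl_compl_inf_inf_xyxzy_eq_inf_compl_inf_compl_xzy (x ⊓ xᶜ)ᶜ ((x ⊓ y) ⊓ z) (x ⊓ y),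
    inf_compl_inf_compl_compl_inf_xxxy x y, compl_compl (x ⊓ y), inf_inf_self_left (x ⊓ y) z]

/-- After x, the disjunction x' ∨ y acts as y: the memory law expands (x' ∨ y) ∧ z to (x' ∧ z) ∨ (x
∧ (y ∧ z)), and behind x the first disjunct shrinks to x ∧ x', which is neutral there. -/
theorem inf_inf_compl_inf_compl_xxyz (x y z : A) : x ⊓ ((x ⊓ yᶜ)ᶜ ⊓ z) = x ⊓ (y ⊓ z) := by
  rw [← inf_inf_inf_compl_inf_compl_xxxyx x ((x ⊓ yᶜ)ᶜ ⊓ z),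
    ← inf_inf_inf_xyxy (x ⊓ xᶜ)ᶜ ((x ⊓ yᶜ)ᶜ ⊓ z),
    inf_inf_inf_compl_inf_compl_xxxyx x (((x ⊓ yᶜ)ᶜ ⊓ z) ⊓ ((x ⊓ xᶜ)ᶜ ⊓ ((x ⊓ yᶜ)ᶜ ⊓ z))),
    ← inf_compl_self_inf x ((x ⊓ yᶜ)ᶜ ⊓ z), inf_inf_compl_inf_xyxx ((x ⊓ yᶜ)ᶜ ⊓ z) (x ⊓ xᶜ),
    inf_inf_compl_inf_compl_xyxx_eq_inf_inf_xyx x ((x ⊓ yᶜ)ᶜ ⊓ z), ← compl_compl ((x ⊓ yᶜ)ᶜ ⊓ z),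
    ← compl_inf_compl_inf_compl_compl_inf_inf_xyxzy_eq_inf_compl_inf_compl_xzy x z y,
    compl_compl ((xᶜ ⊓ z)ᶜ ⊓ (x ⊓ (y ⊓ z))ᶜ),
    ← compl_inf_compl_inf_compl_compl_inf_xyxz x (xᶜ ⊓ z)ᶜ (y ⊓ z), compl_compl (xᶜ ⊓ z),
    inf_compl_inf x z, inf_compl_inf_compl_compl_inf_xxxy x (y ⊓ z), compl_compl (x ⊓ (y ⊓ z))]

/-- Behind x, the element (x ∧ x')' acts as truth: the second x can first be exchanged for it and
then be dropped. -/
theorem inf_inf_cancel (x y : A) : x ⊓ (y ⊓ x) = x ⊓ y := by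
  rw [← inf_inf_compl_inf_compl_xyxx_eq_inf_inf_xyx x y, ← inf_inf_compl_inf_xyxx y (x ⊓ xᶜ),
    inf_compl_self_inf x y, ← inf_inf_inf_compl_inf_compl_xxxyx x (y ⊓ ((x ⊓ xᶜ)ᶜ ⊓ y)),
    inf_inf_inf_xyxy (x ⊓ xᶜ)ᶜ y, inf_inf_inf_compl_inf_compl_xxxyx x y]

theorem inf_compl_inf_self (x y : A) : x ⊓ (x ⊓ y)ᶜ = x ⊓ yᶜ := by
  rw [inf_compl_inf_xxy_eq_inf_inf_compl_xyx x y,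
    ← inf_inf_compl_inf_compl_xyxx_eq_inf_inf_xyx x yᶜ, ← inf_inf_compl_inf_xyxx yᶜ (x ⊓ xᶜ),
    inf_compl_self_inf x yᶜ, ← inf_inf_inf_compl_inf_compl_xxxyx x (yᶜ ⊓ ((x ⊓ xᶜ)ᶜ ⊓ yᶜ)),
    inf_inf_inf_xyxy (x ⊓ xᶜ)ᶜ yᶜ, inf_inf_inf_compl_inf_compl_xxxyx x yᶜ]

/-- Prefix x to the left side. Behind x, the conjunction x ∧ y may be replaced by (x ∧ (x ∧ y)')',
which equals (x ∧ y')', and this acts as y. -/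
theorem inf_assoc (x y z : A) : (x ⊓ y) ⊓ z = x ⊓ (y ⊓ z) := by
  rw [← inf_inf_inf_xxyz x y z, ← inf_inf_compl_inf_compl_xxyz x (x ⊓ y) z,
    inf_compl_inf_xxy_eq_inf_inf_compl_xyx x y,
    ← inf_inf_compl_inf_compl_xyxx_eq_inf_inf_xyx x yᶜ, ← inf_inf_compl_inf_xyxx yᶜ (x ⊓ xᶜ),
    inf_compl_self_inf x yᶜ, ← inf_inf_inf_compl_inf_compl_xxxyx x (yᶜ ⊓ ((x ⊓ xᶜ)ᶜ ⊓ yᶜ)),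
    inf_inf_inf_xyxy (x ⊓ xᶜ)ᶜ yᶜ, inf_inf_inf_compl_inf_compl_xxxyx x yᶜ,
    inf_inf_compl_inf_compl_xxyz x y z]

end MemAlgebra
-- Associativity from the six axioms
/-- Algebras satisfying the six axioms, presented with negation and conjunction only. -/
class DistribAlgebra (A : Type*) extends Compl A, Min A where
  compl_compl (x : A) : xᶜᶜ = x
  inf_distrib (x y z : A) : x ⊓ (y ⊓ z)ᶜ = ((x ⊓ yᶜ)ᶜ ⊓ (x ⊓ zᶜ)ᶜ)ᶜ
  mem (x y z : A) : ((x ⊓ y)ᶜ ⊓ ((xᶜ ⊓ z) ⊓ y)ᶜ)ᶜ = (xᶜ ⊓ zᶜ)ᶜ ⊓ y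
  inf_absorb (x y : A) : x ⊓ (xᶜ ⊓ y)ᶜ = x
  compl_inf_comm (x y : A) : (x ⊓ y)ᶜ ⊓ (y ⊓ x)ᶜ = (y ⊓ x)ᶜ ⊓ (x ⊓ y)ᶜ

namespace DistribAlgebra

variable {A : Type*} [DistribAlgebra A]

theorem inf_idem (x : A) : x ⊓ x = x := by
  nth_rw 2 [← compl_compl x]
  rw [← inf_absorb xᶜ x, inf_absorb x (xᶜᶜ ⊓ x)ᶜ]

theorem inf_compl_inf_inf_compl_xyxz (x y z : A) : x ⊓ (y ⊓ (xᶜ ⊓ z))ᶜ = x ⊓ (y ⊓ xᶜ)ᶜ := by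
  rw [inf_distrib x y (xᶜ ⊓ z), inf_absorb x z]
  nth_rw 2 [← inf_idem x]
  nth_rw 3 [← compl_compl x]
  rw [← inf_distrib x y xᶜ]

theorem compl_inf_compl_compl_inf_xyx (x y : A) : (xᶜ ⊓ (y ⊓ x)ᶜ)ᶜ = (xᶜ ⊓ yᶜ)ᶜ ⊓ x := by
  rw [inf_distrib xᶜ y x, compl_compl ((xᶜ ⊓ yᶜ)ᶜ ⊓ (xᶜ ⊓ xᶜ)ᶜ), inf_idem xᶜ, compl_compl x]

theorem inf_inf_compl_inf_compl_xxxx (x : A) : ((xᶜ ⊓ x)ᶜ ⊓ x) ⊓ x = x := by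
  nth_rw 2 [← compl_compl x]
  rw [← compl_inf_compl_compl_inf_xyx x xᶜ]
  nth_rw 3 [← compl_compl x]
  rw [← inf_compl_inf_inf_compl_xyxz xᶜ xᶜ x, ← compl_inf_compl_compl_inf_xyx x (xᶜ ⊓ (xᶜᶜ ⊓ x))]
  nth_rw 1 [← inf_idem x]
  rw [mem x x (xᶜᶜ ⊓ x), inf_absorb xᶜ x, compl_compl x, inf_idem x]

theorem inf_inf_compl_compl_xxx (x : A) : (xᶜ ⊓ x) ⊓ xᶜ = xᶜ ⊓ x := by
  nth_rw 1 [← compl_compl (xᶜ ⊓ x)]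
  nth_rw 3 [← inf_inf_compl_inf_compl_xxxx x]
  rw [inf_distrib (xᶜ ⊓ x)ᶜᶜ ((xᶜ ⊓ x)ᶜ ⊓ x) x]
  nth_rw 2 [← compl_compl (xᶜ ⊓ x)ᶜ]
  rw [inf_absorb (xᶜ ⊓ x)ᶜᶜ x, compl_compl (xᶜ ⊓ x)ᶜ, inf_absorb (xᶜ ⊓ x)ᶜ xᶜ,
    compl_compl (xᶜ ⊓ x)]

/-- Writing x' ∧ x as (x' ∧ x) ∧ x' makes the left side a memory expansion, with value (x' ∧ x')' ∧
x'. -/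
theorem compl_inf_compl_inf_compl_compl_inf_compl_xxxx (x : A) :
    ((x ⊓ xᶜ)ᶜ ⊓ (xᶜ ⊓ x)ᶜ)ᶜ = x ⊓ xᶜ := by
  nth_rw 1 [← compl_compl x]
  rw [← inf_inf_compl_compl_xxx x]
  nth_rw 3 [← compl_compl xᶜ]
  rw [mem xᶜᶜ xᶜ x, compl_compl xᶜ, inf_idem xᶜ, compl_compl x]

theorem inf_compl_inf_inf_compl_xxyz (x y z : A) : (x ⊓ (xᶜ ⊓ y))ᶜ ⊓ z = (x ⊓ xᶜ)ᶜ ⊓ z := by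
  nth_rw 1 [← compl_compl x]
  rw [← compl_compl (xᶜ ⊓ y)]
  nth_rw 2 [← compl_compl xᶜ]
  rw [← mem xᶜ z (xᶜᶜᶜ ⊓ y)ᶜ, inf_absorb xᶜᶜ y, ← inf_idem xᶜᶜ, mem xᶜ z xᶜᶜ, compl_compl xᶜ,
    compl_compl x]

theorem inf_compl_comm (x : A) : x ⊓ xᶜ = xᶜ ⊓ x := by
  rw [← compl_inf_compl_inf_compl_compl_inf_compl_xxxx x, ← compl_inf_comm xᶜ x]
  nth_rw 3 [← compl_compl x]
  nth_rw 2 [← compl_compl x]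
  rw [compl_inf_compl_inf_compl_compl_inf_compl_xxxx xᶜ, compl_compl x]

theorem inf_compl_inf (x y : A) : x ⊓ (xᶜ ⊓ y) = x ⊓ xᶜ := by
  rw [← compl_compl (x ⊓ (xᶜ ⊓ y)), ← inf_idem (x ⊓ (xᶜ ⊓ y))ᶜ,
    inf_compl_inf_inf_compl_xxyz x y (x ⊓ (xᶜ ⊓ y))ᶜ,
    ← compl_compl ((x ⊓ xᶜ)ᶜ ⊓ (x ⊓ (xᶜ ⊓ y))ᶜ), ← compl_compl (xᶜ ⊓ y),
    ← inf_distrib x x (xᶜ ⊓ y)ᶜ, inf_absorb x y, compl_compl (x ⊓ xᶜ)]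

theorem compl_inf_compl_inf_compl_inf_compl_xyxz (x y z : A) :
    ((x ⊓ y)ᶜ ⊓ (x ⊓ zᶜ)ᶜ)ᶜ = x ⊓ (yᶜ ⊓ z)ᶜ := by
  rw [inf_distrib x yᶜ z, compl_compl y]

theorem inf_compl_compl_inf_xxy (x y : A) : xᶜ ⊓ (x ⊓ y)ᶜ = xᶜ := by
  nth_rw 2 [← compl_compl x]
  rw [inf_absorb xᶜ y]

theorem inf_inf_compl_compl_inf_xxxy (x y : A) : (x ⊓ xᶜ) ⊓ (x ⊓ y)ᶜ = x ⊓ xᶜ := by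
  nth_rw 3 [← compl_compl x]
  rw [← compl_inf_compl_inf_compl_inf_compl_xyxz (x ⊓ xᶜ) xᶜ y]
  nth_rw 1 [inf_compl_comm x]
  nth_rw 2 [← inf_absorb xᶜ xᶜ]
  rw [← inf_compl_comm xᶜ, ← compl_inf_compl_inf_compl_inf_compl_xyxz xᶜ x xᶜᶜ,
    inf_absorb (xᶜ ⊓ x) (xᶜ ⊓ xᶜᶜᶜ)ᶜ, ← inf_compl_comm x, inf_compl_compl_inf_xxy (x ⊓ xᶜ) yᶜ,
    compl_compl (x ⊓ xᶜ)]

theorem inf_inf_compl_compl_inf_inf_xxxyz (x y z : A) : (x ⊓ xᶜ) ⊓ ((x ⊓ y) ⊓ z)ᶜ = x ⊓ xᶜ := by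
  rw [← compl_compl (x ⊓ y), ← compl_inf_compl_inf_compl_inf_compl_xyxz (x ⊓ xᶜ) (x ⊓ y)ᶜ z,
    inf_inf_compl_compl_inf_xxxy x y, inf_compl_compl_inf_xxy (x ⊓ xᶜ) zᶜ, compl_compl (x ⊓ xᶜ)]

theorem inf_inf_compl_compl_inf_inf_inf_xxxyzu (u x y z : A) :
    (x ⊓ xᶜ) ⊓ (((x ⊓ y) ⊓ z) ⊓ u)ᶜ = x ⊓ xᶜ := by
  rw [← compl_compl ((x ⊓ y) ⊓ z),
    ← compl_inf_compl_inf_compl_inf_compl_xyxz (x ⊓ xᶜ) ((x ⊓ y) ⊓ z)ᶜ u,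
    inf_inf_compl_compl_inf_inf_xxxyz x y z, inf_compl_compl_inf_xxy (x ⊓ xᶜ) uᶜ,
    compl_compl (x ⊓ xᶜ)]

theorem compl_inf_inf_compl_compl_inf_xxyz (x y z : A) : ((x ⊓ xᶜ) ⊓ (y ⊓ z)ᶜ)ᶜ = (x ⊓ xᶜ)ᶜ := by
  rw [inf_distrib (x ⊓ xᶜ) y z, compl_compl (((x ⊓ xᶜ) ⊓ yᶜ)ᶜ ⊓ ((x ⊓ xᶜ) ⊓ zᶜ)ᶜ)]
  nth_rw 1 [← inf_inf_compl_compl_inf_inf_xxxyz x x x]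
  rw [← compl_compl ((x ⊓ xᶜ) ⊓ ((x ⊓ x) ⊓ x)ᶜ),
    ← mem ((x ⊓ xᶜ) ⊓ ((x ⊓ x) ⊓ x)ᶜ)ᶜ ((x ⊓ xᶜ) ⊓ zᶜ)ᶜ y,
    ← inf_distrib (x ⊓ xᶜ) ((x ⊓ x) ⊓ x) z, compl_compl ((x ⊓ xᶜ) ⊓ ((x ⊓ x) ⊓ x)ᶜ),
    inf_inf_compl_compl_inf_inf_inf_xxxyzu z x x x, inf_inf_compl_compl_inf_inf_xxxyz x x x,
    inf_inf_compl_compl_inf_inf_inf_xxxyzu ((x ⊓ xᶜ) ⊓ zᶜ)ᶜ x xᶜ y]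

/-- Absorption writes y as (y' ∧ (y ∧ x)')', the negated conjunction to which the preceding lemma
applies. -/
theorem inf_compl_self_inf (x y : A) : (x ⊓ xᶜ) ⊓ y = x ⊓ xᶜ := by
  rw [← compl_compl ((x ⊓ xᶜ) ⊓ y), ← compl_compl y, ← inf_compl_compl_inf_xxy y x,
    compl_inf_inf_compl_compl_inf_xxyz x yᶜ (y ⊓ x)ᶜ, compl_compl (x ⊓ xᶜ)]

theorem inf_compl_inf_xxy (x y : A) : xᶜ ⊓ (x ⊓ y) = x ⊓ xᶜ := by
  nth_rw 2 [← compl_compl x]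
  rw [inf_compl_inf xᶜ y, compl_compl x, ← inf_compl_comm x]

theorem inf_compl_inf_compl_xyx (x y : A) : x ⊓ (yᶜ ⊓ x)ᶜ = x ⊓ y := by
  rw [inf_distrib x yᶜ x, compl_compl y, ← inf_compl_self_inf x y, ← inf_compl_inf_xxy x x,
    mem x y (x ⊓ x)]
  nth_rw 2 [← compl_compl x]
  rw [inf_absorb xᶜ x, compl_compl x]

theorem inf_compl_inf_xyx (x y : A) : x ⊓ (y ⊓ x)ᶜ = x ⊓ yᶜ := by
  rw [← inf_compl_inf_compl_xyx x yᶜ, compl_compl y]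

theorem compl_inf_compl_inf_compl_compl_inf_inf_xyxzy (x y z : A) :
    ((xᶜ ⊓ y)ᶜ ⊓ ((x ⊓ z) ⊓ y)ᶜ)ᶜ = (x ⊓ zᶜ)ᶜ ⊓ y := by
  rw [← compl_compl x, ← mem xᶜ y z, compl_compl x]

theorem inf_inf_compl_inf_compl_xyxx (x y : A) : (x ⊓ y) ⊓ (x ⊓ xᶜ)ᶜ = (x ⊓ y) ⊓ x := by
  rw [inf_compl_comm x]
  nth_rw 3 [← compl_compl x]
  nth_rw 1 [← compl_compl x]
  rw [← inf_compl_inf xᶜ y, inf_compl_inf_compl_xyx (xᶜᶜ ⊓ y) x, compl_compl x]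

theorem compl_inf_compl_inf_xxy (x y : A) : (x ⊓ (x ⊓ y)ᶜ)ᶜ = (x ⊓ yᶜ)ᶜ := by
  rw [← inf_compl_inf_xyx x (x ⊓ y)]
  nth_rw 1 [← compl_compl x]
  rw [← inf_absorb xᶜ xᶜ, compl_compl x, ← inf_inf_compl_inf_compl_xyxx x y,
    compl_inf_compl_inf_compl_compl_inf_inf_xyxzy x (x ⊓ xᶜ)ᶜ y,
    ← compl_compl ((x ⊓ yᶜ)ᶜ ⊓ (x ⊓ xᶜ)ᶜ), ← inf_distrib x y x, inf_compl_inf_xyx x y]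

theorem inf_compl_inf_xxy_eq_inf_compl_xy (x y : A) : x ⊓ (x ⊓ y)ᶜ = x ⊓ yᶜ := by
  rw [← compl_compl (x ⊓ (x ⊓ y)ᶜ), compl_inf_compl_inf_xxy x y, compl_compl (x ⊓ yᶜ)]

theorem inf_inf_xxy (x y : A) : x ⊓ (x ⊓ y) = x ⊓ y := by
  nth_rw 1 [← compl_compl (x ⊓ y)]
  rw [← inf_compl_inf_xxy_eq_inf_compl_xy x (x ⊓ y)ᶜ, inf_compl_inf_xxy_eq_inf_compl_xy x y,
    inf_compl_inf_xxy_eq_inf_compl_xy x yᶜ, compl_compl y]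

theorem inf_inf_self (x y : A) : (x ⊓ y) ⊓ x = x ⊓ y := by
  nth_rw 2 [← compl_compl x]
  rw [← inf_compl_inf_xxy_eq_inf_compl_xy (x ⊓ y) xᶜ, ← inf_compl_inf_xyx (x ⊓ y) x,
    inf_compl_inf_xxy_eq_inf_compl_xy (x ⊓ y) (x ⊓ (x ⊓ y))ᶜ, compl_compl (x ⊓ (x ⊓ y)),
    inf_inf_xxy x y, inf_idem (x ⊓ y)]

theorem compl_inf_inf_compl_inf_compl_inf_inf_inf_compl_compl_inf_compl_xyzxyuxz (u x y z : A) :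
    ((x ⊓ (y ⊓ z)ᶜ) ⊓ (((x ⊓ yᶜ) ⊓ u) ⊓ (x ⊓ zᶜ)ᶜ)ᶜ)ᶜ = ((x ⊓ yᶜ) ⊓ uᶜ)ᶜ ⊓ (x ⊓ zᶜ)ᶜ := by
  rw [← compl_compl (x ⊓ yᶜ), inf_distrib x y z, mem (x ⊓ yᶜ)ᶜ (x ⊓ zᶜ)ᶜ u]

theorem inf_compl_inf_compl_compl_xxx (x : A) : (x ⊓ xᶜ)ᶜ ⊓ xᶜ = xᶜ := by
  nth_rw 3 [← inf_idem x]
  nth_rw 4 [← compl_compl x]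
  rw [← inf_compl_self_inf x xᶜ,
    ← compl_inf_inf_compl_inf_compl_inf_inf_inf_compl_compl_inf_compl_xyzxyuxz x x x xᶜ]
  nth_rw 1 [inf_compl_comm x]
  rw [inf_absorb x x, inf_compl_self_inf x x, compl_compl x, inf_idem x, inf_compl_self_inf x xᶜ,
    inf_compl_comm x, inf_absorb x x]

theorem inf_compl_inf_compl_xxx (x : A) : (x ⊓ xᶜ)ᶜ ⊓ x = x := by
  nth_rw 3 [← compl_compl x]
  rw [inf_compl_comm x]
  nth_rw 2 [← compl_compl x]
  rw [inf_compl_inf_compl_compl_xxx xᶜ, compl_compl x]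

/-- Distribution leaves e ∨ (x ∧ y) with e = x ∧ x'. Since e = e ∧ y and x = e' ∧ x, this is the
memory expansion of (e ∨ x) ∧ y, and e ∨ x = x. -/
theorem inf_compl_inf_compl_xxy (x y : A) : x ⊓ (x ⊓ yᶜ)ᶜ = x ⊓ y := by
  rw [inf_distrib x x yᶜ, compl_compl y, ← inf_compl_self_inf x y, ← compl_compl (x ⊓ xᶜ)]
  nth_rw 3 [← inf_compl_inf_compl_xxx x]
  nth_rw 2 [← compl_compl (x ⊓ xᶜ)ᶜ]
  rw [mem (x ⊓ xᶜ)ᶜᶜ y x, compl_compl (x ⊓ xᶜ)ᶜ, inf_compl_inf_compl_compl_xxx x, compl_compl x]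

theorem inf_compl_inf_self (x y : A) : x ⊓ (x ⊓ y)ᶜ = x ⊓ yᶜ := by
  rw [← inf_compl_inf_compl_xxy x yᶜ, compl_compl y]

theorem inf_inf_self_left (x y : A) : x ⊓ (x ⊓ y) = x ⊓ y := by
  nth_rw 1 [← compl_compl (x ⊓ y)]
  rw [← inf_compl_inf_compl_xxy x (x ⊓ y)ᶜᶜ, compl_compl (x ⊓ y)ᶜ]
  nth_rw 1 [← compl_compl y]
  rw [inf_compl_inf_compl_xxy x yᶜ, ← compl_compl yᶜ, inf_compl_inf_compl_xxy x yᶜᶜ,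
    compl_compl y]

theorem inf_compl_inf_xyx_eq_inf_compl_xy (x y : A) : (x ⊓ y)ᶜ ⊓ x = x ⊓ yᶜ := by
  nth_rw 1 [← compl_compl y]
  nth_rw 1 [← compl_compl x]
  rw [← mem xᶜ x yᶜ, compl_compl x, ← inf_compl_comm x, inf_inf_self x yᶜ]
  nth_rw 1 [← compl_compl yᶜ]
  rw [← inf_distrib x x yᶜᶜ, inf_compl_inf_self x yᶜᶜ, compl_compl yᶜ]

theorem inf_compl_inf_inf_xxyz (x y z : A) : x ⊓ ((x ⊓ y) ⊓ z)ᶜ = x ⊓ (y ⊓ z)ᶜ := by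
  rw [inf_distrib x (x ⊓ y) z, inf_compl_inf_self x y, ← compl_compl ((x ⊓ yᶜ)ᶜ ⊓ (x ⊓ zᶜ)ᶜ),
    ← inf_distrib x y z, compl_compl (x ⊓ (y ⊓ z)ᶜ)]

theorem compl_inf_compl_inf_compl_compl_inf_inf_compl_xxxyz (x y z : A) :
    ((x ⊓ xᶜ)ᶜ ⊓ ((xᶜ ⊓ y) ⊓ z)ᶜ)ᶜ = (xᶜ ⊓ yᶜ)ᶜ ⊓ (xᶜ ⊓ z) := by
  rw [← mem x (xᶜ ⊓ z) y, inf_compl_inf x z, ← compl_compl (xᶜ ⊓ z),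
    ← inf_compl_inf_self (xᶜ ⊓ y) (xᶜ ⊓ z)ᶜ, ← inf_compl_inf_inf_xxyz (xᶜ ⊓ y) xᶜ z,
    inf_compl_inf_self (xᶜ ⊓ y) (((xᶜ ⊓ y) ⊓ xᶜ) ⊓ z)ᶜ, compl_compl (((xᶜ ⊓ y) ⊓ xᶜ) ⊓ z),
    inf_inf_self xᶜ y, inf_inf_self_left (xᶜ ⊓ y) z]

theorem compl_inf_compl_inf_compl_compl_inf_xxyz (x y z : A) :
    ((x ⊓ xᶜ)ᶜ ⊓ (y ⊓ z)ᶜ)ᶜ = ((x ⊓ xᶜ)ᶜ ⊓ yᶜ)ᶜ ⊓ z := by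
  rw [← mem (x ⊓ xᶜ) z y, inf_compl_self_inf x z, inf_compl_inf_inf_xxyz (x ⊓ xᶜ)ᶜ y z]

theorem inf_compl_inf_compl_inf_xyxz (x y z : A) : (x ⊓ yᶜ)ᶜ ⊓ (x ⊓ z) = (x ⊓ y) ⊓ z := by
  nth_rw 2 [← compl_compl x]
  nth_rw 1 [← compl_compl x]
  rw [← compl_inf_compl_inf_compl_compl_inf_inf_compl_xxxyz xᶜ y z,
    compl_inf_compl_inf_compl_compl_inf_xxyz xᶜ (xᶜᶜ ⊓ y) z,
    compl_inf_compl_inf_compl_compl_inf_xxyz xᶜ xᶜᶜ y, compl_compl xᶜ,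
    inf_compl_inf_xyx_eq_inf_compl_xy xᶜ xᶜᶜ, compl_compl xᶜ, inf_idem xᶜ, compl_compl x]

theorem inf_compl_inf_compl_compl_inf_xyxz (x y z : A) :
    (x ⊓ yᶜ)ᶜ ⊓ (x ⊓ z)ᶜ = (x ⊓ (y ⊓ zᶜ)ᶜ)ᶜ := by
  rw [inf_distrib x y zᶜ, compl_compl z, compl_compl ((x ⊓ yᶜ)ᶜ ⊓ (x ⊓ z)ᶜ)]

theorem inf_inf_compl_inf_compl_xyzy (x y z : A) : (x ⊓ (y ⊓ zᶜ)ᶜ) ⊓ y = (x ⊓ y) ⊓ z := by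
  rw [← compl_compl y, ← inf_compl_inf_compl_inf_xyxz x yᶜᶜ z, compl_compl yᶜ,
    ← compl_compl (x ⊓ z), ← inf_compl_inf_xyx_eq_inf_compl_xy (x ⊓ yᶜ)ᶜ (x ⊓ z)ᶜ,
    inf_compl_inf_compl_compl_inf_xyxz x y z, compl_compl (x ⊓ (y ⊓ zᶜ)ᶜ),
    ← inf_compl_inf_inf_xxyz (x ⊓ (y ⊓ zᶜ)ᶜ) x yᶜ, inf_inf_self x (y ⊓ zᶜ)ᶜ,
    inf_compl_inf_self (x ⊓ (y ⊓ zᶜ)ᶜ) yᶜ, compl_compl y]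

/-- Since x ∧ y = (x' ∨ y) ∧ x, the left side is ((x' ∨ y) ∧ x) ∧ z = ((x' ∨ y) ∧ (x' ∨ z)) ∧ x.
Distribution merges the two disjunctions into x' ∨ (y ∧ z), and the first identity is then read
backwards. -/
theorem inf_assoc (x y z : A) : (x ⊓ y) ⊓ z = x ⊓ (y ⊓ z) := by
  nth_rw 1 [← compl_compl y]
  rw [← inf_compl_inf_xyx_eq_inf_compl_xy x yᶜ, ← inf_inf_compl_inf_compl_xyzy (x ⊓ yᶜ)ᶜ x z,
    inf_compl_inf_compl_compl_inf_xyxz x y zᶜ, compl_compl z,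
    inf_compl_inf_xyx_eq_inf_compl_xy x (y ⊓ z)ᶜ, compl_compl (y ⊓ z)]

end DistribAlgebra
namespace DistribAlgebra

/-- The six axioms imply the five axioms. -/
abbrev toMemAlgebra (A : Type*) [DistribAlgebra A] : MemAlgebra A where
  compl_compl := compl_compl
  mem x y z := by rw [← inf_assoc, mem]
  inf_absorb := inf_absorb
  compl_inf_comm := compl_inf_comm

end DistribAlgebra

/-! ### Calculus of conditionals and definedness tests -/

namespace MemAlgebra

variable {A : Type*} [MemAlgebra A]

/-- The disjunction of a `MemAlgebra`, defined by De Morgan's law. -/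
instance : Max A := ⟨fun x y => (xᶜ ⊓ yᶜ)ᶜ⟩

theorem sup_def (x y : A) : x ⊔ y = (xᶜ ⊓ yᶜ)ᶜ := rfl

theorem compl_inf (x y : A) : (x ⊓ y)ᶜ = xᶜ ⊔ yᶜ := by
  simp only [sup_def, compl_compl]

theorem compl_sup (x y : A) : (x ⊔ y)ᶜ = xᶜ ⊓ yᶜ := by
  simp only [sup_def, compl_compl]

theorem compl_injective {x y : A} (h : xᶜ = yᶜ) : x = y := by
  rw [← compl_compl x, h, compl_compl]

theorem sup_inf (x y z : A) : (x ⊔ y) ⊓ z = (x ⊓ z) ⊔ (xᶜ ⊓ (y ⊓ z)) :=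
  (mem x z y).symm

theorem inf_sup_sup (x y z : A) : (x ⊓ y) ⊔ z = (x ⊔ z) ⊓ (xᶜ ⊔ (y ⊔ z)) := by
  apply compl_injective
  simpa only [compl_inf, compl_sup, compl_compl] using sup_inf xᶜ yᶜ zᶜ

theorem inf_sup_self (x y : A) : x ⊓ (x ⊔ y) = x := inf_absorb x yᶜ

theorem sup_inf_self (x y : A) : x ⊔ (x ⊓ y) = x := by
  apply compl_injective
  rw [compl_sup, compl_inf, inf_sup_self]

theorem inf_compl_sup (x y : A) : x ⊓ (xᶜ ⊔ y) = x ⊓ y := by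
  rw [sup_def, compl_compl, inf_compl_inf_self, compl_compl]

theorem sup_compl_inf_self (x y : A) : x ⊔ (xᶜ ⊓ y) = x ⊔ y := by
  apply compl_injective
  rw [compl_sup, compl_inf, inf_compl_sup, compl_sup]

theorem inf_inf_inf_cancel (x y z : A) : x ⊓ (y ⊓ (x ⊓ z)) = x ⊓ (y ⊓ z) := by
  rw [← inf_assoc y, ← inf_assoc x, inf_inf_cancel, inf_assoc]

theorem sup_sup_sup_cancel (x y z : A) : x ⊔ (y ⊔ (x ⊔ z)) = x ⊔ (y ⊔ z) := by
  apply compl_injective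
  simp only [compl_sup, inf_inf_inf_cancel]

/-- The dual memory law and absorption turn the right side into x ∧ (x' ∨ (y ∨ (x ∧ z))). Behind x',
the disjunct x ∧ z may be replaced by z. -/
theorem inf_sup_left (x y z : A) : x ⊓ (y ⊔ z) = (x ⊓ y) ⊔ (x ⊓ z) := by
  have h : xᶜ ⊔ (x ⊓ z) = xᶜ ⊔ z := by
    simpa only [compl_compl] using sup_compl_inf_self xᶜ z
  rw [inf_sup_sup, sup_inf_self, ← sup_sup_sup_cancel, h, sup_sup_sup_cancel, inf_compl_sup]

/-- The conditional "if `a` then `b` else `c`". -/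
def cond (a b c : A) : A := (a ⊓ b) ⊔ (aᶜ ⊓ c)

/-- The element `a ∨ a'`, which tests whether `a` is defined. -/
def dom (a : A) : A := a ⊔ aᶜ

theorem dom_compl (a : A) : dom aᶜ = dom a := by
  simp only [dom, sup_def, compl_compl, inf_compl_comm a]

theorem inf_cond (a b c : A) : a ⊓ cond a b c = a ⊓ b := by
  rw [cond, inf_sup_left, inf_inf_self_left, inf_compl_inf, inf_compl_comm, sup_def,
    compl_inf_inf_compl_zero, compl_compl]

theorem compl_inf_cond (a b c : A) : aᶜ ⊓ cond a b c = aᶜ ⊓ c := by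
  have h : aᶜ ⊓ (a ⊓ b) = aᶜ ⊓ a := by
    simpa only [compl_compl] using inf_compl_inf aᶜ b
  have h' : aᶜ ⊓ (a ⊔ c) = aᶜ ⊓ c := by
    simpa only [compl_compl] using inf_compl_sup aᶜ c
  rw [cond, inf_sup_left, inf_inf_self_left, h, ← inf_sup_left, h']

theorem dom_inf (a y : A) : dom a ⊓ y = (a ⊓ y) ⊔ (aᶜ ⊓ y) := by
  rw [dom, sup_inf, inf_inf_self_left]

/-- Case distinction on a: an element guarded by dom a is determined by what it becomes after a and
after a'. The identities for `cond` below reduce to these three checks. -/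
theorem eq_cond {a b c y : A} (h : dom a ⊓ y = y) (hb : a ⊓ y = a ⊓ b) (hc : aᶜ ⊓ y = aᶜ ⊓ c) :
    y = cond a b c := by
  rw [← h, dom_inf, hb, hc, cond]

theorem dom_inf_cond (a b c : A) : dom a ⊓ cond a b c = cond a b c := by
  rw [dom_inf, inf_cond, compl_inf_cond, cond]

theorem dom_inf_sup (a y : A) : dom a ⊓ (a ⊔ y) = a ⊔ y := by
  have h : (aᶜ ⊓ a) ⊔ (aᶜ ⊓ yᶜ) = aᶜ ⊓ yᶜ := by
    rw [← inf_sup_left]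
    simpa only [compl_compl] using inf_compl_sup aᶜ yᶜ
  apply compl_injective
  rw [compl_inf, compl_sup, dom, compl_sup, compl_compl, h]

theorem compl_cond (a b c : A) : (cond a b c)ᶜ = cond a bᶜ cᶜ := by
  refine eq_cond ?_ ?_ ?_
  · rw [cond, compl_sup, compl_inf a b, ← inf_assoc, ← dom_compl, dom_inf_sup]
  · rw [← inf_compl_inf_self, inf_cond, inf_compl_inf_self]
  · rw [← inf_compl_inf_self, compl_inf_cond, inf_compl_inf_self]

theorem cond_inf (a b c d : A) : cond a b c ⊓ d = cond a (b ⊓ d) (c ⊓ d) := by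
  refine eq_cond ?_ ?_ ?_
  · rw [← inf_assoc, dom_inf_cond]
  · rw [← inf_assoc, inf_cond, inf_assoc]
  · rw [← inf_assoc, compl_inf_cond, inf_assoc]

/-- Behind x, the branches of a conditional matter only up to their values behind x; this lets
rewriting pass under a test. -/
theorem inf_cond_congr (x a b c : A) : x ⊓ cond a (x ⊓ b) (x ⊓ c) = x ⊓ cond a b c := by
  simp only [cond, inf_sup_left, inf_inf_inf_cancel]

theorem dom_sup (a y : A) : dom a ⊔ y = dom a := by
  apply compl_injective
  rw [compl_sup, dom, compl_sup, compl_compl, ← inf_compl_comm, inf_compl_self_inf]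

/-- The negation of dom a is a left zero, so dom a absorbs disjuncts on its right, and so does a
conjunction of two such elements. The commutation axiom for dom a and dom b therefore collapses to
the claim. -/
theorem dom_inf_comm (a b : A) : dom a ⊓ dom b = dom b ⊓ dom a := by
  have h (a b z : A) : (dom a ⊓ dom b) ⊔ z = dom a ⊓ dom b := by
    rw [inf_sup_sup, dom_sup, dom_sup, inf_compl_sup]
  have g : (dom a ⊓ dom b) ⊔ (dom b ⊓ dom a) = (dom b ⊓ dom a) ⊔ (dom a ⊓ dom b) := by
    rw [sup_def, sup_def, compl_inf_comm]
  rwa [h, h] at g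

theorem dom_inf_cond_of_dom_inf {a b m n : A} (hm : dom a ⊓ m = m) (hn : dom a ⊓ n = n) :
    dom a ⊓ cond b m n = cond b m n := by
  refine eq_cond ?_ ?_ ?_
  · rw [← inf_assoc, dom_inf_comm, inf_assoc, dom_inf_cond]
  · rw [← inf_inf_inf_cancel, inf_cond, inf_inf_inf_cancel, hm]
  · rw [← inf_inf_inf_cancel, compl_inf_cond, inf_inf_inf_cancel, hn]

/-- A self-negating u satisfies dom u = u, so it commutes with dom a; on the left it swallows
everything. -/
theorem dom_inf_of_compl_eq {u : A} (hu : uᶜ = u) (a : A) : dom a ⊓ u = u := by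
  have h : dom u = u := by rw [dom, sup_def, hu, hu, inf_idem, hu]
  rw [← h, dom_inf_comm]
  apply compl_injective
  rw [compl_inf, dom, compl_sup, compl_compl, ← inf_compl_comm, hu, inf_idem, ← h, dom_sup]

theorem inf_of_compl_eq {u : A} (hu : uᶜ = u) (x : A) : u ⊓ x = u := by
  simpa only [hu, inf_idem] using inf_compl_self_inf u x

theorem compl_top_inf {t : A} (ht : ∀ x, t ⊓ x = x) (x : A) : tᶜ ⊓ x = tᶜ := by
  apply compl_injective
  simpa only [ht, compl_compl] using inf_absorb t x

/-- A left unit t satisfies dom t = t and hence commutes with dom x. So t is neutral to the right of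
dom x, and x = x ∧ dom x carries this over to x. -/
theorem inf_top {t : A} (ht : ∀ x, t ⊓ x = x) (x : A) : x ⊓ t = x := by
  have h : dom t = t := by rw [dom, sup_def, compl_top_inf ht, compl_compl]
  have h' : dom x ⊓ t = dom x := by rw [← h, dom_inf_comm, h, ht]
  calc x ⊓ t = x ⊓ dom x ⊓ t := by rw [dom, inf_sup_self]
    _ = x := by rw [inf_assoc, h', dom, inf_sup_self]

theorem cond_top_compl_top {t : A} (ht : ∀ x, t ⊓ x = x) (x : A) : cond x t tᶜ = x := by
  symm
  refine eq_cond ?_ ?_ ?_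
  · rw [dom_inf, inf_idem, ← inf_compl_comm, sup_inf_self]
  · rw [inf_idem, inf_top ht]
  · rw [← inf_compl_inf_self, inf_top ht, compl_compl]

end MemAlgebra
-- Adjoining truth and falsity
/-- The extension of `A` by fresh elements for truth and falsity. -/
inductive WithBounds (A : Type*) : Type _
  | top : WithBounds A
  | bot : WithBounds A
  | of (a : A) : WithBounds A

namespace WithBounds

variable {A : Type*} [MemAlgebra A]

instance : Compl (WithBounds A) where
  compl
    | top => bot
    | bot => top
    | of a => of aᶜ

instance : Min (WithBounds A) where
  min
    | top, y => y
    | bot, _ => bot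
    | of a, top => of a
    -- Forced by x ∧ (x ∧ y)' = x ∧ y' at y = `top`, because a ∧ `top` = a.
    | of a, bot => of (a ⊓ aᶜ)
    | of a, of b => of (a ⊓ b)

theorem compl_top : (top : WithBounds A)ᶜ = bot := rfl
theorem compl_bot : (bot : WithBounds A)ᶜ = top := rfl
theorem compl_of (a : A) : (of a)ᶜ = of aᶜ := rfl
theorem top_inf (y : WithBounds A) : top ⊓ y = y := rfl
theorem bot_inf (y : WithBounds A) : bot ⊓ y = bot := rfl
theorem of_inf_top (a : A) : of a ⊓ top = of a := rfl
theorem of_inf_bot (a : A) : of a ⊓ bot = of (a ⊓ aᶜ) := rfl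
theorem of_inf_of (a b : A) : of a ⊓ of b = of (a ⊓ b) := rfl

theorem mem_of_bot_of (a c : A) :
    ((a ⊓ aᶜ)ᶜ ⊓ (aᶜ ⊓ (c ⊓ cᶜ))ᶜ)ᶜ = (aᶜ ⊓ cᶜ)ᶜ ⊓ (aᶜ ⊓ cᶜ) := by
  rw [← MemAlgebra.mem, MemAlgebra.inf_compl_inf, MemAlgebra.inf_inf_inf_cancel]

theorem mem_of_of_top (a b : A) : ((a ⊓ b)ᶜ ⊓ (aᶜ ⊓ b)ᶜ)ᶜ = (aᶜ ⊓ a)ᶜ ⊓ b := by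
  have h := MemAlgebra.dom_inf a b
  simpa only [MemAlgebra.dom, MemAlgebra.sup_def, MemAlgebra.compl_compl] using h.symm

theorem compl_inf_compl_inf (a : A) : (aᶜ ⊓ a)ᶜ ⊓ (aᶜ ⊓ a) = a ⊓ aᶜ := by
  rw [← MemAlgebra.inf_compl_comm a, ← MemAlgebra.inf_compl_comm (a ⊓ aᶜ),
    MemAlgebra.inf_compl_self_inf]

instance : MemAlgebra (WithBounds A) where
  compl_compl x := by
    cases x <;> simp only [compl_top, compl_bot, compl_of, MemAlgebra.compl_compl]
  mem x y z := by
    rcases x with _ | _ | a <;> rcases y with _ | _ | b <;> rcases z with _ | _ | c <;>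
      simp only [compl_top, compl_bot, compl_of, top_inf, bot_inf, of_inf_top, of_inf_bot,
        of_inf_of, MemAlgebra.compl_compl, MemAlgebra.inf_compl_inf_self, MemAlgebra.inf_idem,
        MemAlgebra.mem, mem_of_bot_of, mem_of_of_top, compl_inf_compl_inf,
        MemAlgebra.compl_inf_inf_compl_zero]
  inf_absorb x y := by
    rcases x with _ | _ | a <;> rcases y with _ | _ | b <;>
      simp only [compl_top, compl_bot, compl_of, top_inf, bot_inf, of_inf_top, of_inf_bot,
        of_inf_of, MemAlgebra.compl_compl, MemAlgebra.inf_absorb, MemAlgebra.inf_idem]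
  compl_inf_comm x y := by
    rcases x with _ | _ | a <;> rcases y with _ | _ | b <;>
      simp only [compl_top, compl_bot, compl_of, top_inf, bot_inf, of_inf_top, of_inf_bot,
        of_inf_of, MemAlgebra.compl_inf_comm, MemAlgebra.inf_idem]

end WithBounds
-- Decision trees as normal forms
namespace C

instance : MemAlgebra C where
  compl := neg
  min := and
  compl_compl x := by cases x <;> rfl
  mem x y z := by cases x <;> cases y <;> cases z <;> rfl
  inf_absorb x y := by cases x <;> cases y <;> rfl
  compl_inf_comm x y := by cases x <;> cases y <;> rfl

theorem T_inf (x : C) : T ⊓ x = x := rfl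

theorem compl_U : Uᶜ = U := rfl

theorem cond_T (x y : C) : MemAlgebra.cond T x y = x := by cases x <;> cases y <;> rfl

theorem cond_F (x y : C) : MemAlgebra.cond F x y = y := by cases x <;> cases y <;> rfl

theorem cond_U (x y : C) : MemAlgebra.cond U x y = U := by cases x <;> cases y <;> rfl

end C

/-- Decision trees; the leaf for the undefined truth value is available only if `P` holds. -/
inductive Tree (P : Prop) : Type
  | tt : Tree P
  | ff : Tree P
  | uu (h : P) : Tree P
  | node (n : ℕ) (l r : Tree P) : Tree P

namespace Tree

variable {P : Prop} {A : Type*} [MemAlgebra A]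

/-- The value of a tree, where `t` and `u` denote truth and undefinedness. -/
def ev (t u : A) (v : ℕ → A) : Tree P → A
  | tt => t
  | ff => tᶜ
  | uu _ => u
  | node n l r => MemAlgebra.cond (v n) (l.ev t u v) (r.ev t u v)

/-- The number of inner nodes. -/
def size : Tree P → ℕ
  | tt => 0
  | ff => 0
  | uu _ => 0
  | node _ l r => l.size + r.size + 1

/-- Negation of trees. -/
def neg : Tree P → Tree P
  | tt => ff
  | ff => tt
  | uu h => uu h
  | node n l r => node n l.neg r.neg

/-- Conjunction of trees. -/
def and : Tree P → Tree P → Tree P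
  | tt, q => q
  | ff, _ => ff
  | uu h, _ => uu h
  | node n l r, q => node n (l.and q) (r.and q)

/-- The subtree that remains once the variable `n` is known to be true (`b = true`) or false
(`b = false`). -/
def restrict (n : ℕ) (b : Bool) : Tree P → Tree P
  | tt => tt
  | ff => ff
  | uu h => uu h
  | node m l r =>
    if m = n then bif b then l.restrict n b else r.restrict n b
    else node m (l.restrict n b) (r.restrict n b)

theorem size_restrict_le (n : ℕ) (b : Bool) (p : Tree P) : (p.restrict n b).size ≤ p.size := by
  induction p with
  | node m l r ihl ihr =>
    rw [restrict]
    split_ifs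
    · cases b <;> simp only [cond_true, cond_false, size] <;> omega
    · simp only [size]
      omega
  | _ => exact le_rfl

theorem ev_neg {t u : A} (hu : P → uᶜ = u) (v : ℕ → A) (p : Tree P) :
    p.neg.ev t u v = (p.ev t u v)ᶜ := by
  induction p with
  | tt => rfl
  | ff => exact (MemAlgebra.compl_compl t).symm
  | uu h => exact (hu h).symm
  | node n l r ihl ihr => rw [neg, ev, ev, ihl, ihr, MemAlgebra.compl_cond]

theorem ev_and {t u : A} (ht : ∀ x, t ⊓ x = x) (hu : P → uᶜ = u) (v : ℕ → A) (p q : Tree P) :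
    (p.and q).ev t u v = p.ev t u v ⊓ q.ev t u v := by
  induction p with
  | tt => exact (ht _).symm
  | ff => exact (MemAlgebra.compl_top_inf ht _).symm
  | uu h => exact (MemAlgebra.inf_of_compl_eq (hu h) _).symm
  | node n l r ihl ihr => rw [and, ev, ev, ihl, ihr, MemAlgebra.cond_inf]

/-- Behind `v n`, a test of n selects its first branch; below any other test the induction
hypothesis applies by `MemAlgebra.inf_cond_congr`. -/
theorem inf_ev_restrict (t u : A) (v : ℕ → A) (n : ℕ) (p : Tree P) :
    v n ⊓ (p.restrict n true).ev t u v = v n ⊓ p.ev t u v := by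
  induction p with
  | node m l r ihl ihr =>
    rw [restrict]
    split_ifs with h
    · rw [cond_true, ev, h, MemAlgebra.inf_cond, ihl]
    · rw [ev, ev, ← MemAlgebra.inf_cond_congr, ihl, ihr, MemAlgebra.inf_cond_congr]
  | _ => rfl

theorem compl_inf_ev_restrict (t u : A) (v : ℕ → A) (n : ℕ) (p : Tree P) :
    (v n)ᶜ ⊓ (p.restrict n false).ev t u v = (v n)ᶜ ⊓ p.ev t u v := by
  induction p with
  | node m l r ihl ihr =>
    rw [restrict]
    split_ifs with h
    · rw [cond_false, ev, h, MemAlgebra.compl_inf_cond, ihr]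
    · rw [ev, ev, ← MemAlgebra.inf_cond_congr, ihl, ihr, MemAlgebra.inf_cond_congr]
  | _ => rfl

theorem ev_eq_cond_restrict {t u : A} {v : ℕ → A} {n : ℕ} {p : Tree P}
    (h : MemAlgebra.dom (v n) ⊓ p.ev t u v = p.ev t u v) :
    p.ev t u v =
      MemAlgebra.cond (v n) ((p.restrict n true).ev t u v) ((p.restrict n false).ev t u v) :=
  MemAlgebra.eq_cond h (inf_ev_restrict t u v n p).symm (compl_inf_ev_restrict t u v n p).symm

theorem ev_restrict_update (t u : A) (v : ℕ → A) (n : ℕ) (b : Bool) (a : A) (p : Tree P) :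
    (p.restrict n b).ev t u (Function.update v n a) = (p.restrict n b).ev t u v := by
  induction p with
  | node m l r ihl ihr =>
    rw [restrict]
    split_ifs with h
    · cases b
      · exact ihr
      · exact ihl
    · rw [ev, ev, ihl, ihr, Function.update_of_ne h]
  | _ => rfl

/-- The value of a tree in the algebra `C`. -/
abbrev evC (v : ℕ → C) (p : Tree P) : C := p.ev C.T C.U v

/-- When n has the value T, the guard in `inf_ev_restrict` disappears, and the restricted tree does
not depend on n. -/
theorem evC_restrict_true (v : ℕ → C) (n : ℕ) (p : Tree P) :
    (p.restrict n true).evC v = p.evC (Function.update v n C.T) := by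
  have h := inf_ev_restrict C.T C.U (Function.update v n C.T) n p
  rw [Function.update_self, C.T_inf, C.T_inf, ev_restrict_update] at h
  exact h

theorem evC_restrict_false (v : ℕ → C) (n : ℕ) (p : Tree P) :
    (p.restrict n false).evC v = p.evC (Function.update v n C.F) := by
  have h := compl_inf_ev_restrict C.T C.U (Function.update v n C.F) n p
  rw [Function.update_self, ev_restrict_update] at h
  exact h

/-- If the value of a tree is undefined whenever the variable `n` is, then testing `n` first does
not change the value. -/
theorem dom_inf_ev {t u : A} (hu : P → uᶜ = u) (v : ℕ → A) (n : ℕ) (p : Tree P)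
    (hp : ∀ w : ℕ → C, w n = C.U → p.evC w = C.U) :
    MemAlgebra.dom (v n) ⊓ p.ev t u v = p.ev t u v := by
  induction hs : p.size using Nat.strong_induction_on generalizing p with
  | _ s ih =>
    cases p with
    | tt => exact absurd (hp (fun _ => C.U) rfl) (by simp [evC, ev])
    | ff => exact absurd (hp (fun _ => C.U) rfl) (by simp [evC, ev]; exact nofun)
    | uu h => exact MemAlgebra.dom_inf_of_compl_eq (hu h) _
    | node m l r =>
      by_cases hm : m = n
      · rw [ev, hm, MemAlgebra.dom_inf_cond]
      -- The hypothesis `hp` controls l only where m is true, and r only where m is false.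
      -- Restricting the branches accordingly makes each of them undefined whenever n is, so the
      -- induction applies to them.
      · have e : (node m l r).ev t u v = MemAlgebra.cond (v m)
            ((l.restrict m true).ev t u v) ((r.restrict m false).ev t u v) := by
          rw [ev, MemAlgebra.cond, MemAlgebra.cond, inf_ev_restrict, compl_inf_ev_restrict]
        rw [size] at hs
        rw [e]
        apply MemAlgebra.dom_inf_cond_of_dom_inf
        · refine ih _ ?_ (l.restrict m true) (fun w hw => ?_) rfl
          · have := size_restrict_le m true l
            omega
          · have := hp (Function.update w m C.T) (by rw [Function.update_of_ne (Ne.symm hm), hw])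
            rw [evC, ev, Function.update_self, C.cond_T] at this
            rw [evC_restrict_true, evC, this]
        · refine ih _ ?_ (r.restrict m false) (fun w hw => ?_) rfl
          · have := size_restrict_le m false r
            omega
          · have := hp (Function.update w m C.F) (by rw [Function.update_of_ne (Ne.symm hm), hw])
            rw [evC, ev, Function.update_self, C.cond_F] at this
            rw [evC_restrict_false, evC, this]

/-- Trees with the same values in `C` have the same values in every `MemAlgebra`. -/
theorem ev_eq_of_evC_eq {t u : A} (hu : P → uᶜ = u) (v : ℕ → A) (p q : Tree P)
    (h : ∀ w, p.evC w = q.evC w) : p.ev t u v = q.ev t u v := by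
  induction hs : p.size + q.size using Nat.strong_induction_on generalizing p q with
  | _ s ih =>
    -- A root n on the left makes both trees undefined whenever n is, so both can be split on n. The
    -- left tree loses its root and the right one does not grow, so the total size drops.
    have key (n : ℕ) (l r q : Tree P) (h : ∀ w, (node n l r).evC w = q.evC w)
        (hs : (node n l r).size + q.size = s) : (node n l r).ev t u v = q.ev t u v := by
      have hp (w : ℕ → C) (hw : w n = C.U) : (node n l r).evC w = C.U := by
        rw [evC, ev, hw, C.cond_U]
      have hl := size_restrict_le n true l
      have hr := size_restrict_le n false r
      have hqt := size_restrict_le n true q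
      have hqf := size_restrict_le n false q
      have ht : ((node n l r).restrict n true) = l.restrict n true := by simp [restrict]
      have hf : ((node n l r).restrict n false) = r.restrict n false := by simp [restrict]
      rw [size] at hs
      rw [ev_eq_cond_restrict (dom_inf_ev hu v n (node n l r) hp),
        ev_eq_cond_restrict (dom_inf_ev hu v n q fun w hw => (h w).symm.trans (hp w hw)),
        ih _ (by rw [ht]; omega) ((node n l r).restrict n true) (q.restrict n true)
          (fun w => ?_) rfl,
        ih _ (by rw [hf]; omega) ((node n l r).restrict n false) (q.restrict n false)
          (fun w => ?_) rfl]
      · rw [evC_restrict_false, evC_restrict_false, h]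
      · rw [evC_restrict_true, evC_restrict_true, h]
    cases p with
    | node n l r => exact key n l r q h hs
    | tt =>
      cases q with
      | node n l r => exact (key n l r tt (fun w => (h w).symm) (by omega)).symm
      | tt => rfl
      -- Distinct kinds of leaves have distinct values in C, whatever the valuation.
      | _ => exact absurd (h fun _ => C.U) nofun
    | ff =>
      cases q with
      | node n l r => exact (key n l r ff (fun w => (h w).symm) (by omega)).symm
      | ff => rfl
      | _ => exact absurd (h fun _ => C.U) nofun
    | uu h' =>
      cases q with
      | node n l r => exact (key n l r (uu h') (fun w => (h w).symm) (by omega)).symm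
      | uu => rfl
      | _ => exact absurd (h fun _ => C.U) nofun

end Tree

/-! ### Terms as decision trees -/

namespace Term

variable {K : Set C} {A : Type*} [MemAlgebra A]

/-- The value of a term in a `MemAlgebra`, where `t` and `u` denote truth and undefinedness. -/
def interp (t u : A) (v : ℕ → A) : Term K → A
  | var n => v n
  | const C.T _ => t
  | const C.F _ => tᶜ
  | const C.U _ => u
  | neg s => (s.interp t u v)ᶜ
  | and s₁ s₂ => s₁.interp t u v ⊓ s₂.interp t u v
  | or s₁ s₂ => s₁.interp t u v ⊔ s₂.interp t u v

/-- The decision tree of a term. -/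
def toTree : Term K → Tree (C.U ∈ K)
  | var n => .node n .tt .ff
  | const C.T _ => .tt
  | const C.F _ => .ff
  | const C.U h => .uu h
  | neg s => s.toTree.neg
  | and s₁ s₂ => s₁.toTree.and s₂.toTree
  | or s₁ s₂ => (s₁.toTree.neg.and s₂.toTree.neg).neg

theorem ev_toTree {t u : A} (ht : ∀ x, t ⊓ x = x) (hu : C.U ∈ K → uᶜ = u) (v : ℕ → A)
    (s : Term K) : s.toTree.ev t u v = s.interp t u v := by
  induction s with
  | var n => exact MemAlgebra.cond_top_compl_top ht _
  | const c hc => cases c <;> rfl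
  | neg s ih => rw [toTree, interp, Tree.ev_neg hu, ih]
  | and s₁ s₂ ih₁ ih₂ => rw [toTree, interp, Tree.ev_and ht hu, ih₁, ih₂]
  | or s₁ s₂ ih₁ ih₂ =>
    rw [toTree, interp, Tree.ev_neg hu, Tree.ev_and ht hu, Tree.ev_neg hu, Tree.ev_neg hu, ih₁,
      ih₂, MemAlgebra.sup_def]

theorem interp_C (v : ℕ → C) (s : Term K) : s.interp C.T C.U v = s.eval v := by
  induction s with
  | var n => rfl
  | const c hc => cases c <;> rfl
  | neg s ih => rw [interp, eval, ih]; rfl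
  | and s₁ s₂ ih₁ ih₂ => rw [interp, eval, ih₁, ih₂]; rfl
  | or s₁ s₂ ih₁ ih₂ =>
    rw [interp, eval, ih₁, ih₂]
    cases s₁.eval v <;> cases s₂.eval v <;> rfl

/-- Terms and their trees have equal values both in C and in A: validity becomes agreement of the
trees in C, which transfers to A. -/
theorem interp_eq_of_validInC {t u : A} (ht : ∀ x, t ⊓ x = x) (hu : C.U ∈ K → uᶜ = u)
    (v : ℕ → A) {s₁ s₂ : Term K} (h : ValidInC s₁ s₂) :
    s₁.interp t u v = s₂.interp t u v := by
  rw [← ev_toTree ht hu, ← ev_toTree ht hu]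
  refine Tree.ev_eq_of_evC_eq hu v _ _ fun w => ?_
  rw [Tree.evC, Tree.evC, ev_toTree C.T_inf fun _ => C.compl_U,
    ev_toTree C.T_inf fun _ => C.compl_U, interp_C, interp_C, h]

/-- A term without the constants `T` and `F` takes the same value in the extended algebra. -/
theorem interp_of (hT : C.T ∉ K) (hF : C.F ∉ K) (t : A) (u : A) (v : ℕ → A) (s : Term K) :
    s.interp WithBounds.top (WithBounds.of u) (fun n => WithBounds.of (v n)) =
      WithBounds.of (s.interp t u v) := by
  induction s with
  | var n => rfl
  | const c hc =>
    cases c with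
    | T => exact absurd hc hT
    | F => exact absurd hc hF
    | U => rfl
  | neg s ih => rw [interp, interp, ih]; rfl
  | and s₁ s₂ ih₁ ih₂ => rw [interp, interp, ih₁, ih₂]; rfl
  | or s₁ s₂ ih₁ ih₂ => rw [interp, interp, ih₁, ih₂]; rfl

/-- Without T and F in the terms, evaluation in the extension stays inside the image of A, and
`WithBounds.of` is injective. -/
theorem interp_eq_of_validInC_of_notMem (hT : C.T ∉ K) (hF : C.F ∉ K) (t : A) {u : A}
    (hu : C.U ∈ K → uᶜ = u) (v : ℕ → A) {s₁ s₂ : Term K} (h : ValidInC s₁ s₂) :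
    s₁.interp t u v = s₂.interp t u v := by
  have := interp_eq_of_validInC (t := WithBounds.top) (u := WithBounds.of u) (fun _ => rfl)
    (fun hU => by rw [WithBounds.compl_of, hu hU]) (fun n => WithBounds.of (v n)) h
  rw [interp_of hT hF t, interp_of hT hF t] at this
  exact WithBounds.of.inj this

end Term
-- Terms modulo derivable equality
variable {K : Set C}

namespace Derives

theorem mono {Γ Δ : Set (Equation K)} (h : Γ ⊆ Δ) {s t : Term K} (hd : Derives Γ s t) :
    Derives Δ s t := by
  induction hd with
  | ax e he σ => exact ax e (h he) σ
  | refl s => exact refl s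
  | symm _ ih => exact ih.symm
  | trans _ _ ih₁ ih₂ => exact ih₁.trans ih₂
  | neg _ ih => exact ih.neg
  | and _ _ ih₁ ih₂ => exact ih₁.and ih₂
  | or _ _ ih₁ ih₂ => exact ih₁.or ih₂

/-- Derivable equality as a setoid on terms. -/
def setoid (Γ : Set (Equation K)) : Setoid (Term K) :=
  ⟨Derives Γ, refl, symm, trans⟩

end Derives

/-- The term algebra modulo derivable equality. -/
def Lindenbaum (Γ : Set (Equation K)) : Type := Quotient (Derives.setoid Γ)

namespace Lindenbaum

variable {Γ : Set (Equation K)}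

/-- The class of a term. -/
def mk (s : Term K) : Lindenbaum Γ := Quotient.mk (Derives.setoid Γ) s

theorem mk_eq_mk {s t : Term K} : (mk s : Lindenbaum Γ) = mk t ↔ Derives Γ s t :=
  ⟨Quotient.exact, fun h => Quotient.sound h⟩

theorem ind {p : Lindenbaum Γ → Prop} (h : ∀ s, p (mk s)) (a : Lindenbaum Γ) : p a :=
  Quotient.ind h a

instance : Compl (Lindenbaum Γ) :=
  ⟨Quotient.map Term.neg fun _ _ h => h.neg⟩

instance : Min (Lindenbaum Γ) :=
  ⟨Quotient.map₂ Term.and fun _ _ h _ _ h' => h.and h'⟩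

theorem compl_mk (s : Term K) : (mk s : Lindenbaum Γ)ᶜ = mk s.neg := rfl

theorem mk_inf_mk (s t : Term K) : (mk s : Lindenbaum Γ) ⊓ mk t = mk (s.and t) := rfl

/-- The substitution that replaces `x`, `y`, `z` by the given terms. -/
def assign (r s t : Term K) : ℕ → Term K
  | 0 => r
  | 1 => s
  | _ => t

theorem mk_ax {e : Equation K} (he : e ∈ Γ) (r s t : Term K) :
    (mk (e.lhs.subst (assign r s t)) : Lindenbaum Γ) = mk (e.rhs.subst (assign r s t)) :=
  mk_eq_mk.2 (.ax e he _)

theorem compl_compl (h : ax1a ∈ Γ) (a : Lindenbaum Γ) : aᶜᶜ = a := by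
  induction a using ind with
  | h s => exact mk_ax h s s s

/-- De Morgan's law is applied to the negated terms, and involution removes the double negations. -/
theorem mk_or (ha : ax1a ∈ Γ) (hb : ax1b ∈ Γ) (s t : Term K) :
    (mk (s.or t) : Lindenbaum Γ) = ((mk s)ᶜ ⊓ (mk t)ᶜ)ᶜ := by
  have h : ((mk s)ᶜ ⊓ (mk t)ᶜ)ᶜ = (mk (s.neg.neg.or t.neg.neg) : Lindenbaum Γ) :=
    mk_ax hb s.neg t.neg s
  rw [h, mk_eq_mk]
  exact (mk_eq_mk.1 (compl_compl ha (mk s)).symm).or (mk_eq_mk.1 (compl_compl ha (mk t)).symm)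

theorem inf_absorb (ha : ax1a ∈ Γ) (hb : ax1b ∈ Γ) (hf : ax1f ∈ Γ) (a b : Lindenbaum Γ) :
    a ⊓ (aᶜ ⊓ b)ᶜ = a := by
  induction a using ind with
  | h s =>
    induction b using ind with
    | h t =>
      have h : (mk (s.neg.or (s.neg.and t)) : Lindenbaum Γ) = mk s.neg := mk_ax hf s.neg t s
      rw [mk_or ha hb, ← mk_inf_mk, ← compl_mk, compl_compl ha] at h
      rw [← compl_compl ha (mk s ⊓ _), h, compl_compl ha]

theorem compl_inf_comm (ha : ax1a ∈ Γ) (hb : ax1b ∈ Γ) (hg : ax1g ∈ Γ) (a b : Lindenbaum Γ) :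
    (a ⊓ b)ᶜ ⊓ (b ⊓ a)ᶜ = (b ⊓ a)ᶜ ⊓ (a ⊓ b)ᶜ := by
  induction a using ind with
  | h s =>
    induction b using ind with
    | h t =>
      have h : (mk ((s.and t).or (t.and s)) : Lindenbaum Γ) = mk ((t.and s).or (s.and t)) :=
        mk_ax hg s t s
      rw [mk_or ha hb, mk_or ha hb, ← mk_inf_mk, ← mk_inf_mk] at h
      rw [← compl_compl ha ((mk s ⊓ mk t)ᶜ ⊓ _), h, compl_compl ha]

theorem mem_of_mem1 (ha : ax1a ∈ Γ) (hb : ax1b ∈ Γ) (hm : mem1 ∈ Γ) (a b c : Lindenbaum Γ) :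
    ((a ⊓ b)ᶜ ⊓ (aᶜ ⊓ (c ⊓ b))ᶜ)ᶜ = (aᶜ ⊓ cᶜ)ᶜ ⊓ b := by
  induction a using ind with
  | h r =>
    induction b using ind with
    | h s =>
      induction c using ind with
      | h t =>
        have h : (mk ((r.or t).and s) : Lindenbaum Γ) =
            mk ((r.and s).or (r.neg.and (t.and s))) := mk_ax hm r t s
        rw [← mk_inf_mk, mk_or ha hb, mk_or ha hb] at h
        exact h.symm

/-- The six axioms make the term algebra a `DistribAlgebra`. -/
abbrev distribAlgebra (h : sixAxioms K ⊆ Γ) : DistribAlgebra (Lindenbaum Γ) :=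
  have ha : ax1a ∈ Γ := h (by simp [sixAxioms])
  have hb : ax1b ∈ Γ := h (by simp [sixAxioms])
  { compl_compl := compl_compl ha
    inf_distrib := fun a b c => by
      induction a using ind with
      | h r =>
        induction b using ind with
        | h s =>
          induction c using ind with
          | h t =>
            have hd : ax1d ∈ Γ := h (by simp [sixAxioms])
            have h : (mk (r.and (s.neg.or t.neg)) : Lindenbaum Γ) =
                mk ((r.and s.neg).or (r.and t.neg)) := mk_ax hd r s.neg t.neg
            rw [← mk_inf_mk, mk_or ha hb, mk_or ha hb, ← compl_mk, ← compl_mk, compl_compl ha,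
              compl_compl ha] at h
            exact h
    mem := fun a b c => by
      induction a using ind with
      | h r =>
        induction b using ind with
        | h s =>
          induction c using ind with
          | h t =>
            have hm : mem2 ∈ Γ := h (by simp [sixAxioms])
            have h : (mk ((r.or t).and s) : Lindenbaum Γ) =
                mk ((r.and s).or ((r.neg.and t).and s)) := mk_ax hm r t s
            rw [← mk_inf_mk, mk_or ha hb, mk_or ha hb] at h
            exact h.symm
    inf_absorb := inf_absorb ha hb (h (by simp [sixAxioms]))
    compl_inf_comm := compl_inf_comm ha hb (h (by simp [sixAxioms])) }

end Lindenbaum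

/-! ### Completeness -/

/-- A set of equations that contains the five or the six axioms. -/
def ContainsBase (Γ : Set (Equation K)) : Prop :=
  fiveAxioms K ⊆ Γ ∨ sixAxioms K ⊆ Γ

namespace ContainsBase

variable {Γ : Set (Equation K)}

theorem ax1a_mem (h : ContainsBase Γ) : ax1a ∈ Γ :=
  h.elim (fun h => h (by simp [fiveAxioms])) fun h => h (by simp [sixAxioms])

theorem ax1b_mem (h : ContainsBase Γ) : ax1b ∈ Γ :=
  h.elim (fun h => h (by simp [fiveAxioms])) fun h => h (by simp [sixAxioms])

/-- The term algebra modulo derivable equality is a `MemAlgebra`. -/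
abbrev memAlgebra (h : ContainsBase Γ) : MemAlgebra (Lindenbaum Γ) where
  compl_compl := Lindenbaum.compl_compl h.ax1a_mem
  mem := by
    rcases id h with h' | h'
    · exact Lindenbaum.mem_of_mem1 h.ax1a_mem h.ax1b_mem (h' (by simp [fiveAxioms]))
    -- The first reading of the memory law comes from the second by derived associativity.
    · let := Lindenbaum.distribAlgebra h'
      exact (DistribAlgebra.toMemAlgebra (Lindenbaum Γ)).mem
  inf_absorb := Lindenbaum.inf_absorb h.ax1a_mem h.ax1b_mem <|
    h.elim (fun h => h (by simp [fiveAxioms])) fun h => h (by simp [sixAxioms])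
  compl_inf_comm := Lindenbaum.compl_inf_comm h.ax1a_mem h.ax1b_mem <|
    h.elim (fun h => h (by simp [fiveAxioms])) fun h => h (by simp [sixAxioms])

theorem mono {Δ : Set (Equation K)} (h : ContainsBase Γ) (hΔ : Γ ⊆ Δ) : ContainsBase Δ :=
  h.imp (fun h => h.trans hΔ) fun h => h.trans hΔ

open Lindenbaum in
theorem interp_mk (h : ContainsBase Γ) {t u : Lindenbaum Γ}
    (hT : ∀ h : C.T ∈ K, mk (.const C.T h) = t) (hF : ∀ h : C.F ∈ K, mk (.const C.F h) = tᶜ)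
    (hU : ∀ h : C.U ∈ K, mk (.const C.U h) = u) (s : Term K) :
    letI := h.memAlgebra
    s.interp t u (fun n => mk (.var n)) = mk s := by
  let := h.memAlgebra
  induction s with
  | var n => rfl
  | const c hc =>
    cases c with
    | T => exact (hT hc).symm
    | F => exact (hF hc).symm
    | U => exact (hU hc).symm
  | neg s ih => rw [Term.interp, ih]; rfl
  | and s₁ s₂ ih₁ ih₂ => rw [Term.interp, ih₁, ih₂]; rfl
  | or s₁ s₂ ih₁ ih₂ =>
    rw [Term.interp, ih₁, ih₂, mk_or h.ax1a_mem h.ax1b_mem]; rfl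

open Lindenbaum in
theorem exists_undefined (hU : ∀ h : C.U ∈ K, ax4a h ∈ Γ) :
    ∃ u : Lindenbaum Γ, (∀ h : C.U ∈ K, mk (.const C.U h) = u) ∧ (C.U ∈ K → uᶜ = u) := by
  by_cases h : C.U ∈ K
  · exact ⟨mk (.const C.U h), fun _ => rfl, fun _ => mk_ax (hU h) x x x⟩
  -- If U is not distinguished, no term mentions u and any element will do.
  · exact ⟨mk x, fun h' => absurd h' h, fun h' => absurd h' h⟩

open Lindenbaum in
/-- Completeness in the presence of the constants `T` and `F`. -/
theorem derives_of_validInC (h : ContainsBase Γ) (hT : C.T ∈ K) (hF : C.F ∈ K)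
    (hb : ax4b hT ∈ Γ) (hc : ax4c hT hF ∈ Γ) (hU : ∀ h : C.U ∈ K, ax4a h ∈ Γ) {s₁ s₂ : Term K}
    (hv : ValidInC s₁ s₂) : Derives Γ s₁ s₂ := by
  let := h.memAlgebra
  obtain ⟨u, hu, hu'⟩ := exists_undefined hU
  have ht (a : Lindenbaum Γ) : mk (.const C.T hT) ⊓ a = a := by
    induction a using ind with
    | h s => exact mk_ax hb s s s
  -- Under the valuation of each variable by its own class, a term evaluates to its class, so
  -- equality of values is derivability.
  have := Term.interp_eq_of_validInC ht hu' (fun n => mk (.var n)) hv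
  have hF' (h : C.F ∈ K) : (mk (.const C.F h) : Lindenbaum Γ) = (mk (.const C.T hT))ᶜ :=
    (mk_ax hc x x x).symm
  rw [interp_mk h (fun _ => rfl) hF' hu, interp_mk h (fun _ => rfl) hF' hu] at this
  exact mk_eq_mk.1 this

open Lindenbaum in
/-- Completeness in the absence of the constants `T` and `F`. -/
theorem derives_of_validInC_of_notMem (h : ContainsBase Γ) (hT : C.T ∉ K) (hF : C.F ∉ K)
    (hU : ∀ h : C.U ∈ K, ax4a h ∈ Γ) {s₁ s₂ : Term K} (hv : ValidInC s₁ s₂) :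
    Derives Γ s₁ s₂ := by
  let := h.memAlgebra
  obtain ⟨u, hu, hu'⟩ := exists_undefined hU
  -- The element u also fills the place of truth, which no term mentions.
  have := Term.interp_eq_of_validInC_of_notMem hT hF u hu' (fun n => mk (.var n)) hv
  rw [interp_mk h (fun h => absurd h hT) (fun h => absurd h hF) hu,
    interp_mk h (fun h => absurd h hT) (fun h => absurd h hF) hu] at this
  exact mk_eq_mk.1 this

end ContainsBase
-- Soundness, and independence by finite models
/-- Algebras for the signature with all three constants. -/
structure Model (A : Type*) where
  neg : A → A
  and : A → A → A
  or : A → A → A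
  const : C → A

namespace Model

variable {A : Type*} (M : Model A)

/-- The value of a term in a model. -/
def eval (v : ℕ → A) : Term K → A
  | .var n => v n
  | .const c _ => M.const c
  | .neg s => M.neg (eval v s)
  | .and s t => M.and (eval v s) (eval v t)
  | .or s t => M.or (eval v s) (eval v t)

/-- An equation is satisfied by a model if it holds under all valuations. -/
def Satisfies (e : Equation K) : Prop :=
  ∀ v, M.eval v e.lhs = M.eval v e.rhs

theorem eval_subst (v : ℕ → A) (σ : ℕ → Term K) (s : Term K) :
    M.eval v (s.subst σ) = M.eval (fun n => M.eval v (σ n)) s := by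
  induction s with
  | var n => rfl
  | const c hc => rfl
  | neg s ih => rw [Term.subst, eval, eval, ih]
  | and s t ihs iht => rw [Term.subst, eval, eval, ihs, iht]
  | or s t ihs iht => rw [Term.subst, eval, eval, ihs, iht]

theorem eval_eq_of_derives {Γ : Set (Equation K)} (hΓ : ∀ e ∈ Γ, M.Satisfies e) {s t : Term K}
    (h : Derives Γ s t) (v : ℕ → A) : M.eval v s = M.eval v t := by
  induction h with
  | ax e he σ => rw [eval_subst, eval_subst, hΓ e he]
  | refl s => rfl
  | symm _ ih => exact ih.symm
  | trans _ _ ih₁ ih₂ => exact ih₁.trans ih₂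
  | neg _ ih => rw [eval, eval, ih]
  | and _ _ ih₁ ih₂ => rw [eval, eval, ih₁, ih₂]
  | or _ _ ih₁ ih₂ => rw [eval, eval, ih₁, ih₂]

/-- The algebra `C` as a model. -/
def standard : Model C := ⟨C.neg, C.and, C.or, id⟩

theorem eval_standard (v : ℕ → C) (s : Term K) : standard.eval v s = s.eval v := by
  induction s with
  | var n => rfl
  | const c hc => rfl
  | neg s ih => rw [eval, Term.eval, ih]; rfl
  | and s t ihs iht => rw [eval, Term.eval, ihs, iht]; rfl
  | or s t ihs iht => rw [eval, Term.eval, ihs, iht]; rfl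

end Model

/-- Names for the equations under consideration. -/
inductive Law
  | involution | deMorgan | assoc | distrib | memLeft | memRight | absorb | comm
  | negU | andT | negT
  deriving DecidableEq

namespace Law

/-- The content of a law in a model. -/
def Holds {A : Type*} (M : Model A) : Law → Prop
  | involution => ∀ a, M.neg (M.neg a) = a
  | deMorgan => ∀ a b, M.neg (M.and a b) = M.or (M.neg a) (M.neg b)
  | assoc => ∀ a b c, M.and (M.and a b) c = M.and a (M.and b c)
  | distrib => ∀ a b c, M.and a (M.or b c) = M.or (M.and a b) (M.and a c)
  | memRight => ∀ a b c,
      M.and (M.or a b) c = M.or (M.and a c) (M.and (M.neg a) (M.and b c))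
  | memLeft => ∀ a b c,
      M.and (M.or a b) c = M.or (M.and a c) (M.and (M.and (M.neg a) b) c)
  | absorb => ∀ a b, M.or a (M.and a b) = a
  | comm => ∀ a b, M.or (M.and a b) (M.and b a) = M.or (M.and b a) (M.and a b)
  | negU => M.neg (M.const C.U) = M.const C.U
  | andT => ∀ a, M.and (M.const C.T) a = a
  | negT => M.neg (M.const C.T) = M.const C.F

instance {A : Type*} [Fintype A] [DecidableEq A] (M : Model A) : DecidablePred (Holds M) :=
  fun i => by cases i <;> unfold Holds <;> infer_instance

/-- The equation that a law stands for. -/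
inductive Denotes : Law → Equation K → Prop
  | involution : Denotes involution ax1a
  | deMorgan : Denotes deMorgan ax1b
  | assoc : Denotes assoc ax1c
  | distrib : Denotes distrib ax1d
  | memRight : Denotes memRight mem1
  | memLeft : Denotes memLeft mem2
  | absorb : Denotes absorb ax1f
  | comm : Denotes comm ax1g
  | negU (hU : C.U ∈ K) : Denotes negU (ax4a hU)
  | andT (hT : C.T ∈ K) : Denotes andT (ax4b hT)
  | negT (hT : C.T ∈ K) (hF : C.F ∈ K) : Denotes negT (ax4c hT hF)

/-- Ensures that removing one equation from an axiom set removes its law altogether. -/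
theorem Denotes.unique {i : Law} {e f : Equation K} (he : i.Denotes e) (hf : i.Denotes f) :
    e = f := by
  cases he <;> cases hf <;> rfl

theorem Denotes.satisfies {A : Type*} {M : Model A} {i : Law} {e : Equation K}
    (he : i.Denotes e) (h : i.Holds M) : M.Satisfies e := by
  intro v
  cases he with
  | involution => exact h (v 0)
  | deMorgan => exact h (v 0) (v 1)
  | assoc => exact h (v 0) (v 1) (v 2)
  | distrib => exact h (v 0) (v 1) (v 2)
  | memRight => exact h (v 0) (v 1) (v 2)
  | memLeft => exact h (v 0) (v 1) (v 2)
  | absorb => exact h (v 0) (v 1)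
  | comm => exact h (v 0) (v 1)
  | negU => exact h
  | andT => exact h (v 0)
  | negT => exact h

/-- The valuation of `x`, `y`, `z` by the given elements. -/
def valuation {A : Type*} (a b c : A) : ℕ → A
  | 0 => a
  | 1 => b
  | _ => c

theorem Denotes.holds {A : Type*} [Nonempty A] {M : Model A} {i : Law} {e : Equation K}
    (he : i.Denotes e) (h : M.Satisfies e) : i.Holds M := by
  -- A default value, needed for the laws that contain no variables.
  have o : A := Classical.arbitrary A
  cases he with
  | involution => exact fun a => h (valuation a a a)
  | deMorgan => exact fun a b => h (valuation a b a)
  | assoc => exact fun a b c => h (valuation a b c)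
  | distrib => exact fun a b c => h (valuation a b c)
  | memRight => exact fun a b c => h (valuation a b c)
  | memLeft => exact fun a b c => h (valuation a b c)
  | absorb => exact fun a b => h (valuation a b a)
  | comm => exact fun a b => h (valuation a b a)
  | negU => exact h (valuation o o o)
  | andT => exact fun a => h (valuation a a a)
  | negT => exact h (valuation o o o)

theorem holds_standard (i : Law) : i.Holds Model.standard := by
  cases i with
  | involution => rintro (_ | _ | _) <;> rfl
  | deMorgan => rintro (_ | _ | _) (_ | _ | _) <;> rfl
  | assoc => rintro (_ | _ | _) (_ | _ | _) (_ | _ | _) <;> rfl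
  | distrib => rintro (_ | _ | _) (_ | _ | _) (_ | _ | _) <;> rfl
  | memRight => rintro (_ | _ | _) (_ | _ | _) (_ | _ | _) <;> rfl
  | memLeft => rintro (_ | _ | _) (_ | _ | _) (_ | _ | _) <;> rfl
  | absorb => rintro (_ | _ | _) (_ | _ | _) <;> rfl
  | comm => rintro (_ | _ | _) (_ | _ | _) <;> rfl
  | negU => rfl
  | andT => exact fun _ => rfl
  | negT => rfl

end Law

/-- Soundness for `C`. -/
theorem validInC_of_derives {Γ : Set (Equation K)} (hΓ : ∀ e ∈ Γ, ∃ i : Law, i.Denotes e)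
    {s t : Term K} (h : Derives Γ s t) : ValidInC s t := by
  intro v
  rw [← Model.eval_standard, ← Model.eval_standard]
  refine Model.standard.eval_eq_of_derives (fun e he => ?_) h v
  obtain ⟨i, hi⟩ := hΓ e he
  exact hi.satisfies i.holds_standard

/-- A set of equations is independent if each of the laws it consists of can be refuted in a model
of the others. -/
theorem independent_of_models {Γ : Set (Equation K)} (S : List Law)
    (hΓ : ∀ e ∈ Γ, ∃ i ∈ S, i.Denotes e)
    (hS : ∀ i ∈ S, ∃ (n : ℕ) (M : Model (Fin (n + 1))), ¬ i.Holds M ∧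
      ∀ j ∈ S, j ≠ i → j.Holds M) : Independent Γ := by
  intro e he hd
  obtain ⟨i, hi, hie⟩ := hΓ e he
  obtain ⟨n, M, hM, hS⟩ := hS i hi
  refine hM (hie.holds fun v => M.eval_eq_of_derives (fun f hf => ?_) hd v)
  obtain ⟨j, hj, hjf⟩ := hΓ f hf.1
  refine hjf.satisfies (hS j hj ?_)
  rintro rfl
  exact hf.2 (hjf.unique hie)

namespace Model

/-- The interpretation of the constants `T`, `F`, `U` by the given elements. -/
def constants {A : Type*} (t f u : A) : C → A
  | C.T => t
  | C.F => f
  | C.U => u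

/-- A model with constant negation. -/
def constNeg : Model (Fin 2) :=
  ⟨fun _ => 1, fun a b => if a = b then 1 else 0, fun a _ => a, constants 1 1 1⟩

/-- The two-element group with trivial negation. -/
def group : Model (Fin 2) :=
  ⟨id, fun a b => a + b, fun a _ => a, constants 0 0 0⟩

/-- The three-element chain with `F < U < T`, that is, Kleene's strong three-valued logic. -/
def kleene : Model (Fin 3) :=
  ⟨Fin.rev, min, max, constants 2 0 1⟩

/-- The two-element semilattice with trivial negation. -/
def semilattice : Model (Fin 2) :=
  ⟨id, max, max, constants 0 0 1⟩

/-- Truth `3`, falsity `2` and two distinct undefined values. -/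
def twoUndefined : Model (Fin 4) :=
  ⟨![0, 1, 3, 2], fun a b => if a = 3 then b else a, fun a b => if a = 2 then b else a,
    constants 3 2 0⟩

/-- The operations of `C` on `T = 0`, `F = 1`, `U = 2`, with arbitrary constants. -/
def threeValued (t f u : Fin 3) : Model (Fin 3) :=
  ⟨![1, 0, 2], fun a b => if a = 0 then b else a, fun a b => if a = 1 then b else a,
    constants t f u⟩

/-- A model with nine elements in which conjunction does not distribute over disjunction. -/
def nonDistrib : Model (Fin 9) where
  neg := ![1, 0, 2, 4, 3, 6, 5, 8, 7]
  and a :=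
    if a = 0 then id
    else if a = 3 then ![3, 4, 2, 3, 4, 7, 8, 7, 8]
    else if a = 5 then ![5, 6, 2, 7, 8, 5, 6, 7, 8]
    else if a = 8 then ![8, 7, 2, 8, 7, 8, 7, 7, 8]
    else fun _ => a
  or a :=
    if a = 1 then id
    else if a = 4 then ![3, 4, 2, 3, 4, 7, 8, 7, 8]
    else if a = 6 then ![5, 6, 2, 7, 8, 5, 6, 7, 8]
    else if a = 7 then ![8, 7, 2, 8, 7, 8, 7, 7, 8]
    else fun _ => a
  const := constants 0 1 2

end Model

namespace Law

/-- The laws of the five axioms and of the constants. -/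
def five : List Law := [involution, deMorgan, memRight, absorb, comm, negU, andT, negT]

/-- The laws of the six axioms and of the constants. -/
def six : List Law := [involution, deMorgan, distrib, memLeft, absorb, comm, negU, andT, negT]

/-- The laws for all constants are included at once: for a smaller K the laws present form a
sublist, and the same models still separate them. -/
theorem exists_model_five : ∀ i ∈ five, ∃ (n : ℕ) (M : Model (Fin (n + 1))), ¬ i.Holds M ∧
    ∀ j ∈ five, j ≠ i → j.Holds M := by
  simp only [five, List.forall_mem_cons, List.not_mem_nil, false_implies, implies_true, and_true]
  -- One model per law, in the order of the list. In `kleene` the memory law fails with x undefined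
  -- and y, z true; in `twoUndefined` commutation fails at the two undefined values. The last three
  -- models are C with one constant misplaced: U as truth, T and F as undefined, F as truth.
  refine ⟨⟨_, .constNeg, ?_⟩, ⟨_, .group, ?_⟩, ⟨_, .kleene, ?_⟩, ⟨_, .semilattice, ?_⟩,
    ⟨_, .twoUndefined, ?_⟩, ⟨_, .threeValued 0 1 0, ?_⟩, ⟨_, .threeValued 2 2 2, ?_⟩,
    ⟨_, .threeValued 0 0 2, ?_⟩⟩ <;> decide +kernel

theorem exists_model_six : ∀ i ∈ six, ∃ (n : ℕ) (M : Model (Fin (n + 1))), ¬ i.Holds M ∧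
    ∀ j ∈ six, j ≠ i → j.Holds M := by
  simp only [six, List.forall_mem_cons, List.not_mem_nil, false_implies, implies_true, and_true]
  -- The models for the five axioms serve again. In the additional `nonDistrib`, 3 ∧ (5 ∨ 0) = 3 ∧ 5
  -- = 7, whereas (3 ∧ 5) ∨ (3 ∧ 0) = 7 ∨ 3 = 8.
  refine ⟨⟨_, .constNeg, ?_⟩, ⟨_, .group, ?_⟩, ⟨_, .nonDistrib, ?_⟩, ⟨_, .kleene, ?_⟩,
    ⟨_, .semilattice, ?_⟩, ⟨_, .twoUndefined, ?_⟩, ⟨_, .threeValued 0 1 0, ?_⟩,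
    ⟨_, .threeValued 2 2 2, ?_⟩, ⟨_, .threeValued 0 0 2, ?_⟩⟩ <;> decide +kernel

end Law
-- The theorem for the four choices of constants
theorem exists_denotes_five {e : Equation K} (he : e ∈ fiveAxioms K) :
    ∃ i ∈ Law.five, i.Denotes e := by
  rcases he with rfl | rfl | rfl | rfl | rfl
  · exact ⟨_, by simp [Law.five], .involution⟩
  · exact ⟨_, by simp [Law.five], .deMorgan⟩
  · exact ⟨_, by simp [Law.five], .memRight⟩
  · exact ⟨_, by simp [Law.five], .absorb⟩
  · exact ⟨_, by simp [Law.five], .comm⟩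

theorem exists_denotes_six {e : Equation K} (he : e ∈ sixAxioms K) :
    ∃ i ∈ Law.six, i.Denotes e := by
  rcases he with rfl | rfl | rfl | rfl | rfl | rfl
  · exact ⟨_, by simp [Law.six], .involution⟩
  · exact ⟨_, by simp [Law.six], .deMorgan⟩
  · exact ⟨_, by simp [Law.six], .distrib⟩
  · exact ⟨_, by simp [Law.six], .memLeft⟩
  · exact ⟨_, by simp [Law.six], .absorb⟩
  · exact ⟨_, by simp [Law.six], .comm⟩

theorem exists_denotes_guzmanSquier1 {e : Equation K} (he : e ∈ guzmanSquier1 K) :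
    ∃ i : Law, i.Denotes e := by
  rcases he with rfl | rfl | rfl | rfl | rfl | rfl | rfl
  exacts [⟨_, .involution⟩, ⟨_, .deMorgan⟩, ⟨_, .assoc⟩, ⟨_, .distrib⟩, ⟨_, .memRight⟩,
    ⟨_, .absorb⟩, ⟨_, .comm⟩]

theorem exists_denotes_guzmanSquier2 {e : Equation K} (he : e ∈ guzmanSquier2 K) :
    ∃ i : Law, i.Denotes e := by
  rcases he with rfl | rfl | rfl | rfl | rfl | rfl | rfl
  exacts [⟨_, .involution⟩, ⟨_, .deMorgan⟩, ⟨_, .assoc⟩, ⟨_, .distrib⟩, ⟨_, .memLeft⟩,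
    ⟨_, .absorb⟩, ⟨_, .comm⟩]

theorem fiveAxioms_subset : fiveAxioms K ⊆ guzmanSquier1 K := by
  rintro e (rfl | rfl | rfl | rfl | rfl) <;> simp [guzmanSquier1]

theorem sixAxioms_subset : sixAxioms K ⊆ guzmanSquier2 K := by
  rintro e (rfl | rfl | rfl | rfl | rfl | rfl) <;> simp [guzmanSquier2]

/-- The equations in `E` are axioms for constants, and together with the five or the six axioms
they prove every equation that is valid in `C`. -/
structure Adequate (E : Set (Equation K)) : Prop where
  denotes : ∀ e ∈ E, ∃ i ∈ [Law.negU, Law.andT, Law.negT], i.Denotes e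
  complete : ∀ Γ, ContainsBase Γ → E ⊆ Γ → ∀ {s t : Term K}, ValidInC s t → Derives Γ s t

theorem adequate_empty : Adequate (∅ : Set (Equation ∅)) where
  denotes _ := False.elim
  complete _ h _ _ _ hv := h.derives_of_validInC_of_notMem id id (fun h => h.elim) hv

theorem adequate_axiomsU : Adequate axiomsU where
  denotes := by
    rintro e rfl
    exact ⟨_, by simp, .negU _⟩
  complete _ h hE _ _ hv :=
    h.derives_of_validInC_of_notMem nofun nofun (fun _ => hE rfl) hv

theorem adequate_axiomsTF : Adequate axiomsTF where
  denotes := by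
    rintro e (rfl | rfl)
    · exact ⟨_, by simp, .andT _⟩
    · exact ⟨_, by simp, .negT _ _⟩
  complete _ h hE _ _ hv :=
    h.derives_of_validInC T_mem_constTF F_mem_constTF (hE (Or.inl rfl)) (hE (Or.inr rfl))
      (fun h => by rcases h with h | h <;> cases h) hv

theorem adequate_axiomsTFU : Adequate axiomsTFU where
  denotes := by
    rintro e (rfl | rfl | rfl)
    · exact ⟨_, by simp, .negU _⟩
    · exact ⟨_, by simp, .andT _⟩
    · exact ⟨_, by simp, .negT _ _⟩
  complete _ h hE _ _ hv :=
    h.derives_of_validInC (Set.mem_univ _) (Set.mem_univ _) (hE (Or.inr (Or.inl rfl)))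
      (hE (Or.inr (Or.inr rfl))) (fun _ => hE (Or.inl rfl)) hv

namespace Adequate

variable {E : Set (Equation K)}

theorem derives_iff (hE : Adequate E) {Γ : Set (Equation K)} (hΓ : ContainsBase Γ)
    (hd : ∀ e ∈ Γ, ∃ i : Law, i.Denotes e) (s t : Term K) :
    Derives (Γ ∪ E) s t ↔ ValidInC s t := by
  refine ⟨validInC_of_derives ?_,
    hE.complete _ (hΓ.mono Set.subset_union_left) Set.subset_union_right⟩
  rintro e (he | he)
  · exact hd e he
  · exact (hE.denotes e he).imp fun _ h => h.2

/-- Each of the three derivability relations coincides with validity in C, so the equivalences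
become trivial. -/
theorem completelyAxiomatisesCL (hE : Adequate E) {Γ : Set (Equation K)} (hΓ : ContainsBase Γ)
    (hd : ∀ e ∈ Γ, ∃ i : Law, i.Denotes e) : CompletelyAxiomatisesCL E (Γ ∪ E) := by
  intro s t
  rw [hE.derives_iff hΓ hd, hE.derives_iff (.inl fiveAxioms_subset)
    fun _ => exists_denotes_guzmanSquier1, hE.derives_iff (.inr sixAxioms_subset)
    fun _ => exists_denotes_guzmanSquier2]
  exact ⟨Iff.rfl, Iff.rfl, Iff.rfl⟩

theorem fiveAxioms (hE : Adequate E) :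
    CompletelyAxiomatisesCL E (fiveAxioms K ∪ E) ∧ Independent (fiveAxioms K ∪ E) := by
  refine ⟨hE.completelyAxiomatisesCL (.inl subset_rfl)
    fun e he => (exists_denotes_five he).imp fun _ h => h.2,
    independent_of_models Law.five ?_ Law.exists_model_five⟩
  rintro e (he | he)
  · exact exists_denotes_five he
  · obtain ⟨i, hi, h⟩ := hE.denotes e he
    simp only [List.mem_cons, List.not_mem_nil, or_false] at hi
    exact ⟨i, by rcases hi with rfl | rfl | rfl <;> simp [Law.five], h⟩

theorem sixAxioms (hE : Adequate E) :
    CompletelyAxiomatisesCL E (sixAxioms K ∪ E) ∧ Independent (sixAxioms K ∪ E) := by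
  refine ⟨hE.completelyAxiomatisesCL (.inr subset_rfl)
    fun e he => (exists_denotes_six he).imp fun _ h => h.2,
    independent_of_models Law.six ?_ Law.exists_model_six⟩
  rintro e (he | he)
  · exact exists_denotes_six he
  · obtain ⟨i, hi, h⟩ := hE.denotes e he
    simp only [List.mem_cons, List.not_mem_nil, or_false] at hi
    exact ⟨i, by rcases hi with rfl | rfl | rfl <;> simp [Law.six], h⟩

end Adequate

theorem validInC_ax1c : ValidInC (ax1c : Equation K).lhs (ax1c : Equation K).rhs :=
  fun v => Law.holds_standard .assoc (v 0) (v 1) (v 2)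

/-- Associativity is valid in C, and the axioms that remain after its removal still include the
five, which are complete. -/
theorem not_independent_guzmanSquier1 : ¬ Independent (guzmanSquier1 ∅) := by
  intro h
  refine h ax1c (by simp [guzmanSquier1]) (adequate_empty.complete _ (.inl ?_)
    (Set.empty_subset _) validInC_ax1c)
  refine fun e he => ⟨fiveAxioms_subset he, ?_⟩
  rintro rfl
  -- As a pair of terms, associativity differs from each of the five axioms.
  simp [fiveAxioms, ax1a, ax1b, ax1c, mem1, ax1f, ax1g, x, y, z] at he

theorem not_independent_guzmanSquier2 : ¬ Independent (guzmanSquier2 ∅) := by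
  intro h
  refine h ax1c (by simp [guzmanSquier2]) (adequate_empty.complete _ (.inr ?_)
    (Set.empty_subset _) validInC_ax1c)
  refine fun e he => ⟨sixAxioms_subset he, ?_⟩
  rintro rfl
  simp [sixAxioms, ax1a, ax1b, ax1c, ax1d, mem2, ax1f, ax1g, x, y, z] at he

end CondLogic

theorem mainTheorem7 :
    -- the Guzmán–Squier axioms are not independent, under either reading of (1.1e)
    (¬ CondLogic.Independent (CondLogic.guzmanSquier1 ∅) ∧
      ¬ CondLogic.Independent (CondLogic.guzmanSquier2 ∅)) ∧
    -- (i) no distinguished constants, five axioms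
    (CondLogic.CompletelyAxiomatisesCL ∅ (CondLogic.fiveAxioms ∅) ∧
      CondLogic.Independent (CondLogic.fiveAxioms ∅)) ∧
    -- (ii) no distinguished constants, six axioms
    (CondLogic.CompletelyAxiomatisesCL ∅ (CondLogic.sixAxioms ∅) ∧
      CondLogic.Independent (CondLogic.sixAxioms ∅)) ∧
    -- (iii) only T and F distinguished
    ((CondLogic.CompletelyAxiomatisesCL CondLogic.axiomsTF
          (CondLogic.fiveAxioms CondLogic.constTF ∪ CondLogic.axiomsTF) ∧
        CondLogic.Independent (CondLogic.fiveAxioms CondLogic.constTF ∪ CondLogic.axiomsTF)) ∧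
      (CondLogic.CompletelyAxiomatisesCL CondLogic.axiomsTF
          (CondLogic.sixAxioms CondLogic.constTF ∪ CondLogic.axiomsTF) ∧
        CondLogic.Independent (CondLogic.sixAxioms CondLogic.constTF ∪ CondLogic.axiomsTF))) ∧
    -- (iv) only U distinguished
    ((CondLogic.CompletelyAxiomatisesCL CondLogic.axiomsU
          (CondLogic.fiveAxioms CondLogic.constU ∪ CondLogic.axiomsU) ∧
        CondLogic.Independent (CondLogic.fiveAxioms CondLogic.constU ∪ CondLogic.axiomsU)) ∧
      (CondLogic.CompletelyAxiomatisesCL CondLogic.axiomsU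
          (CondLogic.sixAxioms CondLogic.constU ∪ CondLogic.axiomsU) ∧
        CondLogic.Independent (CondLogic.sixAxioms CondLogic.constU ∪ CondLogic.axiomsU))) ∧
    -- (v) T, F and U distinguished
    ((CondLogic.CompletelyAxiomatisesCL CondLogic.axiomsTFU
          (CondLogic.fiveAxioms Set.univ ∪ CondLogic.axiomsTFU) ∧
        CondLogic.Independent (CondLogic.fiveAxioms Set.univ ∪ CondLogic.axiomsTFU)) ∧
      (CondLogic.CompletelyAxiomatisesCL CondLogic.axiomsTFU
          (CondLogic.sixAxioms Set.univ ∪ CondLogic.axiomsTFU) ∧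
        CondLogic.Independent (CondLogic.sixAxioms Set.univ ∪ CondLogic.axiomsTFU))) := by
  refine ⟨⟨CondLogic.not_independent_guzmanSquier1, CondLogic.not_independent_guzmanSquier2⟩,
    ?_, ?_, ⟨CondLogic.adequate_axiomsTF.fiveAxioms, CondLogic.adequate_axiomsTF.sixAxioms⟩,
    ⟨CondLogic.adequate_axiomsU.fiveAxioms, CondLogic.adequate_axiomsU.sixAxioms⟩,
    ⟨CondLogic.adequate_axiomsTFU.fiveAxioms, CondLogic.adequate_axiomsTFU.sixAxioms⟩⟩
  · simpa only [Set.union_empty] using CondLogic.adequate_empty.fiveAxioms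
  · simpa only [Set.union_empty] using CondLogic.adequate_empty.sixAxioms
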